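/- **Theorem (a Bennett-type inequality for multi-graph dependent variables).** *Setting.* Let $\mathbf X=(\mathbf X_1,\dots,\mathbf X_K)$ be $m=\sum_k m_k\ge 1$ random variables with values in a measurable space $\mathcal X$, in $K$ blocks $\mathbf X_k=(\mathbf x_{k1},\dots,\mathbf x_{km_k})$ (no independence between blocks is assumed). For each $k$ let $G_k$ be a graph on $[m_k]$ that is a dependency graph of $\mathbf X_k$, in the sense that for every independent set $S$ of vertices of $G_k$ the variables $(\mathbf x_{ki})_{i\in S}$ are mutually independent. A *fractional independent vertex cover* of a graph $G$ is a finite family $(I_j,\omega_j)_{j}$ of independent vertex sets $I_j$ and weights $\omega_j\in(0,1]$ with $\sum_{j:\,u\in I_j}\omega_j=1$ for every vertex $u$; the *fractional chromatic number* $\chi_f(G)$ is the minimum of $\sum_j\omega_j$ over all of them. Let $f(\mathbf x)=\sum_{k\in[K]} f_k(\mathbf x_k)$ with $f_k(\mathbf x_k)=\sum_{j\in[J_k]}\omega_{kj}f_{kj}(\mathbf x_{I_{kj}})$, where for each $k$ the family $(I_{kj},\omega_{kj})_{j\in[J_k]}$ is a fractional independent vertex cover of $G_k$ and the covers are optimal,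 that is, $\sum_k\sum_{j}\omega_{kj}=\sum_k\chi_f(G_k)$. Assume each $f_{kj}$ is measurable and sub-additive: there are measurable functions $f_{kj}^{(i)}$, $i\in I_{kj}$, of the coordinates in $I_{kj}\setminus\{i\}$ with $\sum_{i\in I_{kj}}\bigl(f_{kj}(\mathbf x_{I_{kj}})-f_{kj}^{(i)}(\mathbf x_{I_{kj}\setminus\{i\}})\bigr)\le f_{kj}(\mathbf x_{I_{kj}})$ for all $\mathbf x$. Put $$Z=f(\mathbf X)=\sum_{k}\sum_{j}\omega_{kj}Z_{kj},\qquad Z_{kj}=f_{kj}(\mathbf x_{I_{kj}}),\qquad Z_{kj}^{\backslash i}=f^{(i)}_{kj}(\mathbf x_{I_{kj}\setminus\{i\}}).$$ Assume that every $Z_{kj}$ is integrable and that there are a real number $b$, real numbers $\sigma_{kj}$, and square-integrable, $\sigma(\mathbf x_{I_{kj}})$-measurable random variables $Y_{kji}$ ($i\in I_{kj}$) such that, for all $k\in[K]$, $j\in[J_k]$, $i\in I_{kj}$, almost surely $$Y_{kji}\le Z_{kj}-Z_{kj}^{\backslash i}\le 1,\qquad \mathbb E_{kji}[Y_{kji}]\ge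 0,\qquad Y_{kji}\le b,\qquad \sum_{i\in I_{kj}}\mathbb E_{kji}[Y_{kji}^2]\le\sigma_{kj}^2,$$ where $\mathbb E_{kji}$ is the conditional expectation given $\mathbf x_{I_{kj}\setminus\{i\}}$. Let $$v_{kj}=(1+b)\,\mathbb E[Z_{kj}]+\sigma_{kj}^2,\quad \sigma^2=\sum_k\sum_j\omega_{kj}\sigma_{kj}^2,\quad v=(1+b)\,\mathbb E[Z]+\sigma^2,\quad W=\sum_k\chi_f(G_k),$$ $$U=\sum_{k}\sum_{j}\omega_{kj}\max\Bigl(1,\ v_{kj}^{1/2}W^{1/2}v^{-1/2}\Bigr),\qquad \varphi(x)=(1+x)\log(1+x)-x .$$ *Conclusion.* 1. For every $t>0$, $$\mathbb P\bigl(Z\ge \mathbb E[Z]+t\bigr)\le\exp\Bigl(-\frac vW\,\varphi\Bigl(\frac{tW}{Uv}\Bigr)\Bigr)\le\exp\Bigl(-\frac{v}{\sum_k\chi_f(G_k)}\,\varphi\Bigl(\frac{4t}{5v}\Bigr)\Bigr)$$ (if $v=0$, the two right-hand sides are read as $1$ and this part is void). 2. For every $t>0$, with $c=\frac{25}{16}\sum_k\chi_f(G_k)$,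 $$\mathbb P\Bigl(Z\ge\mathbb E[Z]+\sqrt{2cvt}+\frac{2ct}{3}\Bigr)\le e^{-t}.$$ -/

import Mathlib

open MeasureTheory ProbabilityTheory

/-- `(I_j, ω_j)_{j ∈ J}` is a fractional independent vertex cover of `G`: the weights lie in
`(0, 1]`, each `I_j` is an independent set of `G`, and every vertex has total weight one. -/
structure IsFracIndepCover {V J : Type*} [DecidableEq V] [Fintype J] (G : SimpleGraph V)
    (I : J → Finset V) (ω : J → ℝ) : Prop where
  weight_pos : ∀ j, 0 < ω j
  weight_le_one : ∀ j, ω j ≤ 1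
  sum_eq_one : ∀ u : V, ∑ j with u ∈ I j, ω j = 1
  indep : ∀ j, G.IsIndepSet (I j : Set V)

/-- The fractional chromatic number: the least total weight of a fractional independent vertex
cover. -/
noncomputable def fracChromaticNumber {V : Type*} [DecidableEq V] (G : SimpleGraph V) : ℝ :=
  sInf {r : ℝ | ∃ (n : ℕ) (I : Fin n → Finset V) (ω : Fin n → ℝ),
    IsFracIndepCover G I ω ∧ r = ∑ j, ω j}

/-- `G` is a dependency graph of the random variables `(x_i)_{i ∈ V}`: variables whose indices are
not joined by edges are independent, that is, the variables indexed by any independent set of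
vertices are mutually independent. (This is implied by the requirement that `x_A` and `x_B` are
independent for disjoint `A`, `B` without an edge between them.) -/
def IsDependencyGraph {Ω V 𝒳 : Type*} [MeasurableSpace Ω] [MeasurableSpace 𝒳] (μ : Measure Ω)
    (x : V → Ω → 𝒳) (G : SimpleGraph V) : Prop :=
  ∀ S : Set V, G.IsIndepSet S → iIndepFun (fun i : S => x i) μ

/-- `f` is sub-additive, with the functions `g i` of all the coordinates but the `i`-th as
witnesses: `∑ i, (f x - g i (x without x_i)) ≤ f x`. -/
def IsSubadditiveVia {ι 𝒳 : Type*} [Fintype ι] (f : (ι → 𝒳) → ℝ)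
    (g : ∀ i : ι, ({l : ι // l ≠ i} → 𝒳) → ℝ) : Prop :=
  ∀ x : ι → 𝒳, ∑ i, (f x - g i fun l => x l) ≤ f x

/-- A decomposition that exhibits `f` as a multi-fractionally sub-additive function with respect
to the graphs `G_1, …, G_K`: `f(x) = ∑ k, f_k(x_k)`, each `f_k` is fractionally colorable with
respect to `G_k` through `(f_kj, I_kj, ω_kj)_j`, and each `f_kj` is sub-additive. -/
structure MultiFracDecomposition {K : ℕ} {m : Fin K → ℕ} {𝒳 : Type*} [MeasurableSpace 𝒳]
    (G : ∀ k, SimpleGraph (Fin (m k))) (f : (∀ k, Fin (m k) → 𝒳) → ℝ) where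
  /-- the functions `f_k` of the blocks -/
  block : ∀ k, (Fin (m k) → 𝒳) → ℝ
  /-- the number `J_k` of pieces of `f_k` -/
  J : Fin K → ℕ
  /-- the sets `I_kj` -/
  I : ∀ k, Fin (J k) → Finset (Fin (m k))
  /-- the weights `ω_kj` -/
  ω : ∀ k, Fin (J k) → ℝ
  /-- the functions `f_kj` -/
  piece : ∀ k (j : Fin (J k)), (I k j → 𝒳) → ℝ
  /-- the functions `f_kj^{(i)}` of the coordinates in `I_kj` other than `i` which witness the
  sub-additivity of `f_kj` -/
  deleted : ∀ k (j : Fin (J k)) (i : I k j), ({l : I k j // l ≠ i} → 𝒳) → ℝ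
  eq_sum_block : ∀ x, f x = ∑ k, block k (x k)
  cover : ∀ k, IsFracIndepCover (G k) (I k) (ω k)
  block_eq : ∀ k (x : Fin (m k) → 𝒳), block k x = ∑ j, ω k j * piece k j fun i => x i
  subadditive : ∀ k j, IsSubadditiveVia (piece k j) (deleted k j)
  measurable_piece : ∀ k j, Measurable (piece k j)
  measurable_deleted : ∀ k j i, Measurable (deleted k j i)

namespace MultiFracDecomposition

variable {K : ℕ} {m : Fin K → ℕ} {𝒳 Ω : Type*} [MeasurableSpace 𝒳]
  {G : ∀ k, SimpleGraph (Fin (m k))} {f : (∀ k, Fin (m k) → 𝒳) → ℝ}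

/-- The random variable `Z_kj = f_kj(x_{I_kj})`. -/
def Z (D : MultiFracDecomposition G f) (X : ∀ k, Fin (m k) → Ω → 𝒳) (k : Fin K)
    (j : Fin (D.J k)) (w : Ω) : ℝ :=
  D.piece k j fun i => X k i w

/-- The random variable `Z_kj^{∖i} = f_kj^{(i)}(x_{I_kj ∖ {i}})`. -/
def ZDel (D : MultiFracDecomposition G f) (X : ∀ k, Fin (m k) → Ω → 𝒳) (k : Fin K)
    (j : Fin (D.J k)) (i : D.I k j) (w : Ω) : ℝ :=
  D.deleted k j i fun l => X k l w

/-- The σ-algebra generated by `x_{I_kj}`. -/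
abbrev sigmaAlg (D : MultiFracDecomposition G f) (X : ∀ k, Fin (m k) → Ω → 𝒳) (k : Fin K)
    (j : Fin (D.J k)) : MeasurableSpace Ω :=
  MeasurableSpace.comap (fun w (i : D.I k j) => X k i w) inferInstance

/-- The σ-algebra generated by `x_{I_kj ∖ {i}}`. -/
abbrev sigmaAlgDel (D : MultiFracDecomposition G f) (X : ∀ k, Fin (m k) → Ω → 𝒳) (k : Fin K)
    (j : Fin (D.J k)) (i : D.I k j) : MeasurableSpace Ω :=
  MeasurableSpace.comap (fun w (l : {l : D.I k j // l ≠ i}) => X k l w) inferInstance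

/-- The assumption on the pieces: `Y_kji` is `σ(x_{I_kj})`-measurable,
`Y_kji ≤ Z_kj - Z_kj^{∖i} ≤ 1`, `E_kji[Y_kji] ≥ 0`, `Y_kji ≤ b_kj` and
`∑ i, E_kji[Y_kji ^ 2] ≤ σ_kj ^ 2` almost surely, where `E_kji` is the conditional expectation
given `x_{I_kj ∖ {i}}`. The expectations and conditional expectations exist: `Z_kj` is integrable
and `Y_kji` is square-integrable. -/
structure PieceAssumption [MeasurableSpace Ω] (μ : Measure Ω) (D : MultiFracDecomposition G f)
    (X : ∀ k, Fin (m k) → Ω → 𝒳) (Y : ∀ k (j : Fin (D.J k)), D.I k j → Ω → ℝ)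
    (b σ : ∀ k, Fin (D.J k) → ℝ) : Prop where
  integrable_Z : ∀ k j, Integrable (D.Z X k j) μ
  memLp_Y : ∀ k j i, MemLp (Y k j i) 2 μ
  measurable_Y : ∀ k j i, Measurable[D.sigmaAlg X k j] (Y k j i)
  Y_le_sub : ∀ k j i, ∀ᵐ w ∂μ, Y k j i w ≤ D.Z X k j w - D.ZDel X k j i w
  sub_le_one : ∀ k j i, ∀ᵐ w ∂μ, D.Z X k j w - D.ZDel X k j i w ≤ 1
  condExp_nonneg : ∀ k j i, ∀ᵐ w ∂μ, 0 ≤ (μ[Y k j i | D.sigmaAlgDel X k j i]) w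
  Y_le : ∀ k j i, ∀ᵐ w ∂μ, Y k j i w ≤ b k j
  sum_condExp_sq_le : ∀ k j, ∀ᵐ w ∂μ,
    ∑ i, (μ[fun w' => Y k j i w' ^ 2 | D.sigmaAlgDel X k j i]) w ≤ σ k j ^ 2

end MultiFracDecomposition

/-- `φ(x) = (1 + x) log (1 + x) - x`. -/
noncomputable def bennettPhi (x : ℝ) : ℝ := (1 + x) * Real.log (1 + x) - x

/-! Each piece `Z_kj` depends only on the variables of an independent set, hence on independent
variables, and is sub-additive. The entropy method gives it a Bennett bound, log E exp(l(Z_kj − E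
Z_kj)) ≤ v_kj ψ(l) with ψ(l) = e^l − 1 − l. The pieces may depend on each other arbitrarily, so they
are combined by convexity alone, and Chernoff's method finishes.

One piece. Write Z for it, Z^i for its deleted version, x = Z − Z^i, and θ(y) = 1 − e^y + y e^y. The
modified logarithmic Sobolev inequality (`entropy_exp_le`) bounds the entropy of e^{lZ} by the sum
over i of E[e^{lZ^i} θ(lx)]. With a = 1/(1+b), the calculus bound θ(lx) ≤ c(l)·(x e^{lx} + a x² − x)
holds for x ≤ 1, and a x² − x may be replaced by a Y² − Y. Here E[e^{lZ^i} Y] ≥ 0, sub-additivity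
sums the terms x e^{lZ}, and the conditional second moments sum to at most σ². The result is a
linear differential inequality for the log-mgf (`mul_integral_sub_le`). It has an integrating
factor, and lE[Z] + vψ(l) solves it with equality, which gives `log_mgf_le`.

Combination (`integral_exp_sum_le`). Let M_q = max(1, (v_q W/v)^{1/2}). Jensen's inequality with
weights ω_q M_q / U runs piece q at the rate lU/M_q. Because ψ(rs) ≤ r²ψ(s) for 0 ≤ r ≤ 1 and v_q ≤
(v/W) M_q², every piece obeys the same bound exp((v/W) ψ(lU)). Optimality of the covers enters as W
= Σ ω_q. The explicit constant follows from max(1, x) ≤ 1 + x²/4, which gives U ≤ 5W/4. -/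

/-! ### Calculus of the entropy integrand θ. -/

/-- The function `y ↦ 1 - e^y + y e^y`. -/
noncomputable def entropyTheta (y : ℝ) : ℝ := 1 - Real.exp y + y * Real.exp y

lemma entropyTheta_nonneg (y : ℝ) : 0 ≤ entropyTheta y := by
  have h := Real.add_one_le_exp (-y)
  have h1 : Real.exp (-y) * Real.exp y = 1 := by rw [← Real.exp_add]; simp
  have h2 := Real.exp_pos y
  unfold entropyTheta
  nlinarith

lemma hasDerivAt_entropyTheta (y : ℝ) : HasDerivAt entropyTheta (y * Real.exp y) y := by
  have h := ((hasDerivAt_const y (1 : ℝ)).sub (Real.hasDerivAt_exp y)).add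
    ((hasDerivAt_id y).mul (Real.hasDerivAt_exp y))
  refine h.congr_deriv ?_
  simp

lemma entropyTheta_mul_le {l x : ℝ} (hl : 0 ≤ l) (hx : x ≤ 1) :
    entropyTheta (l * x) ≤ x ^ 2 * entropyTheta l := by
  have hd : ∀ s : ℝ, HasDerivAt (fun s => x ^ 2 * entropyTheta s - entropyTheta (s * x))
      (x ^ 2 * s * (Real.exp s - Real.exp (s * x))) s := fun s => by
    have h := ((hasDerivAt_entropyTheta s).const_mul (x ^ 2)).sub
      ((hasDerivAt_entropyTheta (s * x)).comp s ((hasDerivAt_id s).mul_const x))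
    refine h.congr_deriv ?_
    simp only [one_mul]
    ring
  have hmono : MonotoneOn (fun s => x ^ 2 * entropyTheta s - entropyTheta (s * x))
      (Set.Ici 0) := by
    refine monotoneOn_of_deriv_nonneg (convex_Ici 0)
      (fun s _ => (hd s).continuousAt.continuousWithinAt)
      (fun s _ => (hd s).differentiableAt.differentiableWithinAt) fun s hs => ?_
    rw [interior_Ici, Set.mem_Ioi] at hs
    rw [(hd s).deriv]
    have : Real.exp (s * x) ≤ Real.exp s := Real.exp_le_exp.2 (by nlinarith)
    have : 0 ≤ Real.exp s - Real.exp (s * x) := by linarith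
    positivity
  have h := hmono Set.self_mem_Ici (Set.mem_Ici.2 hl) hl
  simp only [zero_mul, entropyTheta, Real.exp_zero] at h ⊢
  linarith

lemma monotone_two_mul_entropyTheta_sub :
    Monotone fun y => 2 * entropyTheta y - y * (Real.exp y - 1) := by
  have hd : ∀ y : ℝ, HasDerivAt (fun y => 2 * entropyTheta y - y * (Real.exp y - 1))
      (entropyTheta y) y := fun y => by
    have h := ((hasDerivAt_entropyTheta y).const_mul 2).sub
      ((hasDerivAt_id y).mul ((Real.hasDerivAt_exp y).sub_const 1))
    refine h.congr_deriv ?_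
    simp only [entropyTheta, id]
    ring
  exact monotone_of_deriv_nonneg (fun y => (hd y).differentiableAt)
    fun y => by rw [(hd y).deriv]; exact entropyTheta_nonneg y

lemma sq_mul_exp_le_sq_exp_sub_one {y : ℝ} (hy : 0 ≤ y) :
    y ^ 2 * Real.exp y ≤ (Real.exp y - 1) ^ 2 := by
  have h1 := Real.self_le_sinh_iff.2 (show 0 ≤ y / 2 by linarith)
  rw [Real.sinh_eq] at h1
  have h2 : Real.exp y = Real.exp (y / 2) ^ 2 := by rw [← Real.exp_nat_mul]; ring_nf
  have h3 : Real.exp (-(y / 2)) * Real.exp (y / 2) = 1 := by rw [← Real.exp_add]; simp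
  have h4 := Real.exp_pos (y / 2)
  have h5 : y * Real.exp (y / 2) ≤ Real.exp y - 1 := by nlinarith
  calc y ^ 2 * Real.exp y = (y * Real.exp (y / 2)) ^ 2 := by rw [h2]; ring
    _ ≤ _ := by gcongr

lemma monotoneOn_entropyTheta_div :
    MonotoneOn (fun y => entropyTheta y / (y * (Real.exp y - 1))) (Set.Ioi 0) := by
  have hpos : ∀ y : ℝ, 0 < y → 0 < y * (Real.exp y - 1) := fun y hy =>
    mul_pos hy (sub_pos.2 (Real.one_lt_exp_iff.2 hy))
  have hd : ∀ y : ℝ, 0 < y → HasDerivAt (fun y => entropyTheta y / (y * (Real.exp y - 1)))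
      (((Real.exp y - 1) ^ 2 - y ^ 2 * Real.exp y) / (y * (Real.exp y - 1)) ^ 2) y :=
    fun y hy => by
    have h := (hasDerivAt_entropyTheta y).div
      ((hasDerivAt_id y).mul ((Real.hasDerivAt_exp y).sub_const 1)) (hpos y hy).ne'
    refine h.congr_deriv ?_
    simp only [entropyTheta, Pi.mul_apply, id]
    congr 1
    ring
  refine monotoneOn_of_deriv_nonneg (convex_Ioi 0)
    (fun s hs => (hd s hs).continuousAt.continuousWithinAt)
    (fun s hs => (hd s (by simpa using hs)).differentiableAt.differentiableWithinAt) fun s hs => ?_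
  rw [interior_Ioi, Set.mem_Ioi] at hs
  rw [(hd s hs).deriv]
  have := sq_mul_exp_le_sq_exp_sub_one hs.le
  exact div_nonneg (by linarith) (sq_nonneg _)

/-- For x > 0 this is monotonicity of θ(y)/(y(e^y − 1)) on y > 0, which rests on y ≤ 2 sinh(y/2).
For x ≤ 0 the value 1/2 separates the two ratios, since 2θ(y) − y(e^y − 1) is increasing and
vanishes at 0. -/
lemma entropyTheta_mul_exp_sub_one_le {l x : ℝ} (hl : 0 < l) (hx : x ≤ 1) :
    entropyTheta (l * x) * (Real.exp l - 1) ≤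
      entropyTheta l * (x * (Real.exp (l * x) - 1)) := by
  have hE : 0 < Real.exp l - 1 := sub_pos.2 (Real.one_lt_exp_iff.2 hl)
  rcases lt_or_ge 0 x with h0 | h0
  · have hlx : 0 < l * x := mul_pos hl h0
    have hE' : 0 < Real.exp (l * x) - 1 := sub_pos.2 (Real.one_lt_exp_iff.2 hlx)
    have h := monotoneOn_entropyTheta_div (Set.mem_Ioi.2 hlx) (Set.mem_Ioi.2 hl)
      (by nlinarith : l * x ≤ l)
    simp only at h
    rw [div_le_div_iff₀ (mul_pos hlx hE') (mul_pos hl hE)] at h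
    refine le_of_mul_le_mul_left ?_ hl
    linarith
  · have hlx : l * x ≤ 0 := mul_nonpos_of_nonneg_of_nonpos hl.le h0
    have hE' : Real.exp (l * x) - 1 ≤ 0 := sub_nonpos.2 (Real.exp_le_one_iff.2 hlx)
    have h1 := monotone_two_mul_entropyTheta_sub hlx
    have h2 := monotone_two_mul_entropyTheta_sub hl.le
    simp only [entropyTheta, Real.exp_zero] at h1 h2
    have hp : 0 ≤ x * (Real.exp (l * x) - 1) := mul_nonneg_of_nonpos_of_nonpos h0 hE'
    have h3 : entropyTheta (l * x) ≤ 1 / 2 * (l * (x * (Real.exp (l * x) - 1))) := by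
      unfold entropyTheta; linarith
    have h4 : 1 / 2 * (l * (Real.exp l - 1)) ≤ entropyTheta l := by
      unfold entropyTheta; linarith
    calc _ ≤ 1 / 2 * (l * (x * (Real.exp (l * x) - 1))) * (Real.exp l - 1) := by gcongr
      _ = 1 / 2 * (l * (Real.exp l - 1)) * (x * (Real.exp (l * x) - 1)) := by ring
      _ ≤ _ := by gcongr

/-- Adds the preceding bound to `a` times θ(lx) ≤ x²θ(l). The first term will be summed by
sub-additivity, the second by the variance hypothesis. -/
lemma entropyTheta_mul_le_div_mul {l x a : ℝ} (hl : 0 < l) (hx : x ≤ 1) (ha : 0 ≤ a) :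
    entropyTheta (l * x) ≤
      entropyTheta l / (Real.exp l - 1 + a) * (x * (Real.exp (l * x) - 1) + a * x ^ 2) := by
  have hE : 0 < Real.exp l - 1 := sub_pos.2 (Real.one_lt_exp_iff.2 hl)
  rw [div_mul_eq_mul_div, le_div_iff₀ (by linarith)]
  have h1 := entropyTheta_mul_exp_sub_one_le hl hx
  have h2 := mul_le_mul_of_nonneg_left (entropyTheta_mul_le hl.le hx) ha
  linarith

lemma mul_sq_sub_le_of_add_le {a x y : ℝ} (hyx : y ≤ x) (h : a * (x + y) ≤ 1) :
    a * x ^ 2 - x ≤ a * y ^ 2 - y := by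
  nlinarith

/-! ### The exponent ψ of Bennett's bound. -/

/-- The function `x ↦ e^x - 1 - x`. -/
noncomputable def bennettPsi (x : ℝ) : ℝ := Real.exp x - 1 - x

lemma bennettPsi_nonneg (x : ℝ) : 0 ≤ bennettPsi x := by
  have := Real.add_one_le_exp x
  unfold bennettPsi; linarith

lemma hasDerivAt_bennettPsi (x : ℝ) : HasDerivAt bennettPsi (Real.exp x - 1) x :=
  (((Real.hasDerivAt_exp x).sub_const 1).sub (hasDerivAt_id x))

lemma mul_exp_sub_one_mul_le {s r : ℝ} (hr0 : 0 ≤ r) (hr : r ≤ 1) :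
    Real.exp (r * s) - 1 ≤ r * (Real.exp s - 1) := by
  have := convexOn_exp.2 (Set.mem_univ s) (Set.mem_univ 0) hr0 (sub_nonneg.2 hr) (by ring)
  simp only [smul_eq_mul, mul_zero, add_zero, Real.exp_zero, mul_one] at this
  linarith

/-- Convexity of exp makes the difference increasing in `s`. This quadratic scaling lets pieces with
different variances share one exponent. -/
lemma bennettPsi_mul_le {s r : ℝ} (hs : 0 ≤ s) (hr0 : 0 ≤ r) (hr : r ≤ 1) :
    bennettPsi (r * s) ≤ r ^ 2 * bennettPsi s := by
  have hd : ∀ s : ℝ, HasDerivAt (fun s => r ^ 2 * bennettPsi s - bennettPsi (r * s))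
      (r * (r * (Real.exp s - 1) - (Real.exp (r * s) - 1))) s := fun s => by
    have h := ((hasDerivAt_bennettPsi s).const_mul (r ^ 2)).sub
      ((hasDerivAt_bennettPsi (r * s)).comp s ((hasDerivAt_id s).const_mul r))
    refine h.congr_deriv ?_
    ring
  have hmono : MonotoneOn (fun s => r ^ 2 * bennettPsi s - bennettPsi (r * s))
      (Set.Ici 0) := by
    refine monotoneOn_of_deriv_nonneg (convex_Ici 0)
      (fun s _ => (hd s).continuousAt.continuousWithinAt)
      (fun s _ => (hd s).differentiableAt.differentiableWithinAt) fun s hs => ?_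
    rw [(hd s).deriv]
    exact mul_nonneg hr0 (sub_nonneg.2 (mul_exp_sub_one_mul_le hr0 hr))
  have h := hmono Set.self_mem_Ici (Set.mem_Ici.2 hs) hs
  simp only [mul_zero, bennettPsi, Real.exp_zero] at h ⊢
  linarith

/-! ### Conditional expectation and independent σ-algebras. -/

theorem MeasureTheory.setIntegral_inter_of_indep {Ω : Type*} {m₁ m₂ m₀ : MeasurableSpace Ω}
    {μ : Measure Ω} [IsProbabilityMeasure μ] (h₁ : m₁ ≤ m₀) (h₂ : m₂ ≤ m₀) (hind : Indep m₁ m₂ μ)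
    {f : Ω → ℝ} (hf : StronglyMeasurable[m₁] f) (hfi : Integrable f μ) {s t : Set Ω}
    (hs : MeasurableSet[m₁] s) (ht : MeasurableSet[m₂] t) :
    ∫ w in s ∩ t, f w ∂μ = μ.real t * ∫ w in s, f w ∂μ := by
  have hi : Integrable (s.indicator f) μ := hfi.indicator (h₁ _ hs)
  rw [Set.inter_comm, ← setIntegral_indicator (h₁ _ hs), ← setIntegral_condExp h₂ hi ht,
    setIntegral_congr_ae (g := fun _ => ∫ w, s.indicator f w ∂μ) (h₂ _ ht),
    setIntegral_const, smul_eq_mul, integral_indicator (h₁ _ hs)]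
  filter_upwards [condExp_indep_eq h₁ h₂ (hf.indicator hs) hind] with w hw _ using hw

/-- The sets u ∩ v, with u in `m₃` and v in `m₂`, form a π-system generating the join. Over such a
set both integrals factor as μ(v) times an integral over u, where they agree by definition. -/
theorem MeasureTheory.condExp_sup_of_indep {Ω : Type*} {m₁ m₂ m₃ m₀ : MeasurableSpace Ω}
    {μ : Measure Ω} [IsProbabilityMeasure μ] (h₁ : m₁ ≤ m₀) (h₂ : m₂ ≤ m₀) (h₃ : m₃ ≤ m₁)
    (hind : Indep m₁ m₂ μ)
    {f : Ω → ℝ} (hf : StronglyMeasurable[m₁] f) :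
    μ[f | m₃ ⊔ m₂] =ᵐ[μ] μ[f | m₃] := by
  by_cases hfi : Integrable f μ
  swap
  · simp [condExp_of_not_integrable hfi]
  have hle : m₃ ⊔ m₂ ≤ m₀ := sup_le (h₃.trans h₁) h₂
  symm
  refine ae_eq_condExp_of_forall_setIntegral_eq hle hfi
    (fun s _ _ => integrable_condExp.integrableOn) ?_
    (stronglyMeasurable_condExp.mono (le_sup_left : m₃ ≤ m₃ ⊔ m₂)).aestronglyMeasurable
  intro s hs _
  have hgen : m₃ ⊔ m₂ = MeasurableSpace.generateFrom
      (Set.image2 (· ∩ ·) {s | MeasurableSet[m₃] s} {s | MeasurableSet[m₂] s}) := by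
    refine le_antisymm (sup_le ?_ ?_) (MeasurableSpace.generateFrom_le ?_)
    · intro u hu
      exact MeasurableSpace.measurableSet_generateFrom ⟨u, hu, Set.univ, MeasurableSet.univ, by simp⟩
    · intro u hu
      exact MeasurableSpace.measurableSet_generateFrom ⟨Set.univ, MeasurableSet.univ, u, hu, by simp⟩
    · rintro _ ⟨u, hu, v, hv, rfl⟩
      exact MeasurableSet.inter ((le_sup_left : m₃ ≤ m₃ ⊔ m₂) _ hu)
        ((le_sup_right : m₂ ≤ m₃ ⊔ m₂) _ hv)
  have hpi : IsPiSystem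
      (Set.image2 (· ∩ ·) {s | MeasurableSet[m₃] s} {s | MeasurableSet[m₂] s}) := by
    rintro _ ⟨u, hu, v, hv, rfl⟩ _ ⟨u', hu', v', hv', rfl⟩ _
    exact ⟨u ∩ u', MeasurableSet.inter hu hu', v ∩ v', MeasurableSet.inter hv hv',
      Set.inter_inter_inter_comm _ _ _ _⟩
  have hall := integral_condExp (μ := μ) (f := f) (h₃.trans h₁)
  induction s, hs using MeasurableSpace.induction_on_inter hgen hpi with
  | empty => simp
  | basic t ht =>
    obtain ⟨u, hu, v, hv, rfl⟩ := ht
    rw [setIntegral_inter_of_indep h₁ h₂ hind (stronglyMeasurable_condExp.mono h₃)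
      integrable_condExp (h₃ _ hu) hv,
      setIntegral_inter_of_indep h₁ h₂ hind hf hfi (h₃ _ hu) hv,
      setIntegral_condExp (h₃.trans h₁) hfi hu]
  | compl t ht ih =>
    have e1 := integral_add_compl (hle _ ht) hfi
    have e2 := integral_add_compl (hle _ ht) (integrable_condExp (μ := μ) (f := f) (m := m₃))
    have := ih (measure_lt_top _ _)
    linarith
  | iUnion g hd hg ih =>
    rw [integral_iUnion (fun i => hle _ (hg i)) hd integrable_condExp.integrableOn,
      integral_iUnion (fun i => hle _ (hg i)) hd hfi.integrableOn]
    exact tsum_congr fun i => ih i (measure_lt_top _ _)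

/-! ### Modified logarithmic Sobolev inequality on a product. -/

/-- The σ-algebra generated by the members of the family `𝓕` with index in `S`. -/
abbrev sigmaOn {Ω ι : Type*} (𝓕 : ι → MeasurableSpace Ω) (S : Set ι) : MeasurableSpace Ω :=
  ⨆ i ∈ S, 𝓕 i

section Product

variable {Ω ι : Type*} {m₀ : MeasurableSpace Ω} {μ : Measure Ω} [IsProbabilityMeasure μ]
  {𝓕 : ι → MeasurableSpace Ω}

lemma sigmaOn_le (hle : ∀ i, 𝓕 i ≤ m₀) (S : Set ι) : sigmaOn 𝓕 S ≤ m₀ :=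
  iSup₂_le fun i _ => hle i

lemma sigmaOn_mono {S T : Set ι} (h : S ⊆ T) : sigmaOn 𝓕 S ≤ sigmaOn 𝓕 T :=
  biSup_mono h

/-- The complement of `i` splits into `S \ {i}` and `Sᶜ`, and the second part is independent of
everything `f` sees. -/
lemma condExp_sigmaOn_compl_singleton (hle : ∀ i, 𝓕 i ≤ m₀) (hind : iIndep 𝓕 μ) {S : Set ι}
    {i : ι} (hi : i ∈ S) {f : Ω → ℝ} (hf : StronglyMeasurable[sigmaOn 𝓕 S] f) :
    μ[f | sigmaOn 𝓕 {i}ᶜ] =ᵐ[μ] μ[f | sigmaOn 𝓕 (S \ {i})] := by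
  have h := condExp_sup_of_indep (sigmaOn_le hle S) (sigmaOn_le hle Sᶜ)
    (sigmaOn_mono (𝓕 := 𝓕) (Set.sdiff_subset : S \ {i} ⊆ S))
    (indep_iSup_of_disjoint hle hind disjoint_compl_right) hf
  have hS : ({i}ᶜ : Set ι) = S \ {i} ∪ Sᶜ := by
    ext l
    by_cases hl : l ∈ S
    · simp [hl]
    · simpa [hl] using fun h : l = i => hl (h ▸ hi)
  rw [hS, show sigmaOn 𝓕 (S \ {i} ∪ Sᶜ) = sigmaOn 𝓕 (S \ {i}) ⊔ sigmaOn 𝓕 Sᶜ from iSup_union]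
  exact h

/-- If `Z` exceeds each of its averages over one coordinate by at most one, then it exceeds its
mean by at most the number of coordinates. -/
theorem ae_le_card_add_integral [Fintype ι] (hle : ∀ i, 𝓕 i ≤ m₀) (hind : iIndep 𝓕 μ)
    {Z : Ω → ℝ} (hZm : StronglyMeasurable[sigmaOn 𝓕 Set.univ] Z) (hZi : Integrable Z μ)
    (hZ : ∀ i, ∀ᵐ w ∂μ, Z w ≤ 1 + (μ[Z | sigmaOn 𝓕 {i}ᶜ]) w) :
    ∀ᵐ w ∂μ, Z w ≤ Fintype.card ι + ∫ w', Z w' ∂μ := by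
  classical
  have key : ∀ s : Finset ι, ∀ᵐ w ∂μ, Z w ≤ s.card + (μ[Z | sigmaOn 𝓕 (s : Set ι)ᶜ]) w := by
    intro s
    induction s using Finset.induction_on with
    | empty =>
      rw [Finset.coe_empty, Set.compl_empty, condExp_of_stronglyMeasurable (sigmaOn_le hle _) hZm hZi]
      simp
    | insert i s hi ih =>
      -- Averaging the bound for `s` over coordinate `i` keeps its constant; the hypothesis on `i`
      -- costs one more.
      have hm := condExp_mono (m := sigmaOn 𝓕 {i}ᶜ) hZi
        ((integrable_const (s.card : ℝ)).add integrable_condExp) ih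
      have hadd := condExp_add (μ := μ) (integrable_const (s.card : ℝ))
        (integrable_condExp (f := Z) (m := sigmaOn 𝓕 (s : Set ι)ᶜ)) (sigmaOn 𝓕 {i}ᶜ)
      have hK := condExp_sigmaOn_compl_singleton hle hind (S := (s : Set ι)ᶜ) (i := i)
        (by simpa using hi) (stronglyMeasurable_condExp (μ := μ) (f := Z))
      have ht := condExp_condExp_of_le (μ := μ) (f := Z)
        (sigmaOn_mono (𝓕 := 𝓕) (Set.sdiff_subset : (s : Set ι)ᶜ \ {i} ⊆ (s : Set ι)ᶜ))
        (sigmaOn_le hle _)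
      have hS : ((insert i s : Finset ι) : Set ι)ᶜ = (s : Set ι)ᶜ \ {i} := by
        ext l; simp [and_comm]
      rw [hS, Finset.card_insert_of_notMem hi]
      rw [condExp_const (sigmaOn_le hle _)] at hadd
      filter_upwards [hZ i, hm, hadd, hK, ht] with w h1 h2 h3 h4 h5
      have h3' : (μ[(fun w => s.card + (μ[Z | sigmaOn 𝓕 (s : Set ι)ᶜ]) w) | sigmaOn 𝓕 {i}ᶜ]) w
        = s.card + (μ[μ[Z | sigmaOn 𝓕 (s : Set ι)ᶜ] | sigmaOn 𝓕 {i}ᶜ]) w := h3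
      have h2' := h2.trans_eq h3'
      push_cast
      linarith
  have h := key Finset.univ
  have hb : sigmaOn 𝓕 ((Finset.univ : Finset ι) : Set ι)ᶜ = ⊥ := by simp [sigmaOn]
  rw [hb, condExp_bot] at h
  simpa using h

lemma condExp_exp_mem_Icc {m : MeasurableSpace Ω} (hm : m ≤ m₀) {g : Ω → ℝ}
    (hg : AEStronglyMeasurable[m₀] g μ) {C : ℝ} (hC : ∀ᵐ w ∂μ, |g w| ≤ C) :
    ∀ᵐ w ∂μ, Real.exp (-C) ≤ (μ[fun w => Real.exp (g w) | m]) w ∧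
      (μ[fun w => Real.exp (g w) | m]) w ≤ Real.exp C := by
  have hi : Integrable (fun w => Real.exp (g w)) μ := by
    refine Integrable.of_bound (Real.continuous_exp.comp_aestronglyMeasurable hg) (Real.exp C) ?_
    filter_upwards [hC] with w hw
    rw [Real.norm_eq_abs, Real.abs_exp]
    exact Real.exp_le_exp.2 (abs_le.1 hw).2
  have h1 := condExp_mono (m := m) (integrable_const (Real.exp (-C))) hi
    (by filter_upwards [hC] with w hw using Real.exp_le_exp.2 (abs_le.1 hw).1)
  have h2 := condExp_mono (m := m) hi (integrable_const (Real.exp C))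
    (by filter_upwards [hC] with w hw using Real.exp_le_exp.2 (abs_le.1 hw).2)
  rw [condExp_const hm] at h1 h2
  filter_upwards [h1, h2] with w a b using ⟨a, b⟩

/-- The ratio is a density in coordinate `i`: given all other coordinates its conditional mean is
one, so it does not change the integral of a function that ignores `i`. -/
lemma integral_mul_condExp_div_condExp (hle : ∀ i, 𝓕 i ≤ m₀) (hind : iIndep 𝓕 μ) {S : Set ι}
    {i : ι} (hi : i ∈ S) {g : Ω → ℝ} (hg : AEStronglyMeasurable g μ) {C : ℝ}
    (hC : ∀ᵐ w ∂μ, |g w| ≤ C) {H : Ω → ℝ} (hHm : StronglyMeasurable[sigmaOn 𝓕 {i}ᶜ] H)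
    (hHi : Integrable H μ) :
    Integrable (fun w => H w * ((μ[fun w => Real.exp (g w) | sigmaOn 𝓕 S]) w /
        (μ[fun w => Real.exp (g w) | sigmaOn 𝓕 (S \ {i})]) w)) μ ∧
      ∫ w, H w * ((μ[fun w => Real.exp (g w) | sigmaOn 𝓕 S]) w /
        (μ[fun w => Real.exp (g w) | sigmaOn 𝓕 (S \ {i})]) w) ∂μ = ∫ w, H w ∂μ := by
  set f : Ω → ℝ := fun w => Real.exp (g w)
  set F := μ[f | sigmaOn 𝓕 S]
  set F' := μ[f | sigmaOn 𝓕 (S \ {i})]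
  have hFm : StronglyMeasurable[sigmaOn 𝓕 S] F := stronglyMeasurable_condExp
  have hFm' : StronglyMeasurable[sigmaOn 𝓕 (S \ {i})] F' := stronglyMeasurable_condExp
  have hsub : sigmaOn 𝓕 (S \ {i}) ≤ sigmaOn 𝓕 S := sigmaOn_mono Set.sdiff_subset
  have hrm : StronglyMeasurable[sigmaOn 𝓕 S] fun w => F w / F' w := hFm.div (hFm'.mono hsub)
  have hF := condExp_exp_mem_Icc (sigmaOn_le hle S) hg hC
  have hF' := condExp_exp_mem_Icc (sigmaOn_le hle (S \ {i})) hg hC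
  have hb : ∀ᵐ w ∂μ, ‖F w / F' w‖ ≤ Real.exp C / Real.exp (-C) := by
    filter_upwards [hF, hF'] with w h1 h2
    have p1 := (Real.exp_pos (-C)).trans_le h1.1
    have p2 := (Real.exp_pos (-C)).trans_le h2.1
    rw [Real.norm_eq_abs, abs_of_pos (div_pos p1 p2)]
    exact div_le_div₀ (Real.exp_pos _).le h1.2 (Real.exp_pos _) h2.1
  have hrms := (hrm.mono (sigmaOn_le hle S)).aestronglyMeasurable (μ := μ)
  have hri : Integrable (fun w => F w / F' w) μ := Integrable.of_bound hrms _ hb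
  have hint : Integrable (fun w => H w * (F w / F' w)) μ := hHi.mul_bdd hrms hb
  refine ⟨hint, ?_⟩
  have h1 : μ[fun w => F w / F' w | sigmaOn 𝓕 (S \ {i})] =ᵐ[μ] fun _ => 1 := by
    have e1 := condExp_mul_of_stronglyMeasurable_right (μ := μ) (m := sigmaOn 𝓕 (S \ {i}))
      (f := F) (g := fun w => (F' w)⁻¹) hFm'.measurable.inv.stronglyMeasurable
      (by simpa [Pi.mul_def, div_eq_mul_inv] using hri) integrable_condExp
    have e2 := condExp_condExp_of_le (μ := μ) (f := f) hsub (sigmaOn_le hle _)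
    filter_upwards [e1, e2, hF'] with w a1 a2 a3
    have p := (Real.exp_pos (-C)).trans_le a3.1
    have a1' : (μ[fun w => F w / F' w | sigmaOn 𝓕 (S \ {i})]) w
      = (μ[F | sigmaOn 𝓕 (S \ {i})]) w * (F' w)⁻¹ := a1
    rw [a1', a2]
    exact mul_inv_cancel₀ p.ne'
  have h2 := condExp_sigmaOn_compl_singleton hle hind hi hrm
  have h3 := condExp_mul_of_stronglyMeasurable_left (μ := μ) hHm (g := fun w => F w / F' w) hint hri
  rw [← integral_condExp (sigmaOn_le hle {i}ᶜ)]
  refine integral_congr_ae ?_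
  filter_upwards [h1, h2, h3] with w a1 a2 a3
  refine a3.trans ?_
  rw [Pi.mul_apply, a2, a1, mul_one]

/-- Young's duality between entropy and exp, from 1 + x ≤ e^x at x = h + u − g. It is what makes the
functions `h i` arbitrary in the entropy bound. -/
lemma exp_mul_le_young (g h u : ℝ) :
    Real.exp g * u ≤ Real.exp g * (g - h) - Real.exp g + Real.exp h * Real.exp u := by
  have h1 := Real.add_one_le_exp (h + u - g)
  have h2 : Real.exp g * Real.exp (h + u - g) = Real.exp h * Real.exp u := by
    rw [← Real.exp_add, ← Real.exp_add]; ring_nf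
  have h3 := mul_le_mul_of_nonneg_left h1 (Real.exp_pos g).le
  rw [h2] at h3
  linarith

/-- Modified logarithmic Sobolev inequality for bounded functions of independent σ-algebras. -/
theorem entropy_exp_le_of_bounded [Fintype ι] (hle : ∀ i, 𝓕 i ≤ m₀) (hind : iIndep 𝓕 μ)
    {g : Ω → ℝ} (hgm : StronglyMeasurable[sigmaOn 𝓕 Set.univ] g) {C : ℝ}
    (hC : ∀ᵐ w ∂μ, |g w| ≤ C) {h : ι → Ω → ℝ}
    (hhm : ∀ i, StronglyMeasurable[sigmaOn 𝓕 {i}ᶜ] (h i)) (hhi : ∀ i, Integrable (h i) μ)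
    (hhe : ∀ i, Integrable (fun w => Real.exp (h i w)) μ) :
    ∫ w, Real.exp (g w) * g w ∂μ -
        (∫ w, Real.exp (g w) ∂μ) * Real.log (∫ w, Real.exp (g w) ∂μ) ≤
      ∑ i, ∫ w, (Real.exp (g w) * (g w - h i w) - Real.exp (g w) + Real.exp (h i w)) ∂μ := by
  classical
  have hg : AEStronglyMeasurable g μ := (hgm.mono (sigmaOn_le hle _)).aestronglyMeasurable
  have hfs : AEStronglyMeasurable (fun w => Real.exp (g w)) μ :=
    Real.continuous_exp.comp_aestronglyMeasurable hg
  have hfb : ∀ᵐ w ∂μ, ‖Real.exp (g w)‖ ≤ Real.exp C := by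
    filter_upwards [hC] with w hw
    rw [Real.norm_eq_abs, Real.abs_exp]
    exact Real.exp_le_exp.2 (abs_le.1 hw).2
  have hfi : Integrable (fun w => Real.exp (g w)) μ := Integrable.of_bound hfs _ hfb
  have hgi : Integrable g μ := Integrable.of_bound hg C hC
  have hfg : Integrable (fun w => Real.exp (g w) * g w) μ := hgi.bdd_mul hfs hfb
  have hfh : ∀ i, Integrable (fun w => Real.exp (g w) * (g w - h i w) - Real.exp (g w)) μ :=
    fun i => ((hgi.sub (hhi i)).bdd_mul hfs hfb).sub hfi
  set F : Set ι → Ω → ℝ := fun S => μ[fun w => Real.exp (g w) | sigmaOn 𝓕 S] with hFdef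
  -- The logarithm of e^g / E[e^g] telescopes into increments log F(S) − log F(S \ {i}). Young's
  -- inequality treats each one, and `r i` is the exponential of the increment, with conditional
  -- mean one.
  have key : ∀ s : Finset ι, ∃ r : ι → Ω → ℝ,
      (∀ i ∈ s, Integrable (fun w => Real.exp (h i w) * r i w) μ ∧
        ∫ w, Real.exp (h i w) * r i w ∂μ = ∫ w, Real.exp (h i w) ∂μ) ∧
      ∀ᵐ w ∂μ, Real.exp (g w) * (g w - Real.log (F (s : Set ι)ᶜ w)) ≤
        ∑ i ∈ s, (Real.exp (g w) * (g w - h i w) - Real.exp (g w) +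
          Real.exp (h i w) * r i w) := by
    intro s
    induction s using Finset.induction_on with
    | empty =>
      refine ⟨fun _ _ => 0, by simp, ?_⟩
      have : F ((∅ : Finset ι) : Set ι)ᶜ = fun w => Real.exp (g w) := by
        rw [hFdef, Finset.coe_empty, Set.compl_empty]
        exact condExp_of_stronglyMeasurable (sigmaOn_le hle _)
          (Real.continuous_exp.comp_stronglyMeasurable hgm) hfi
      rw [this]
      simp
    | insert i s hi ih =>
      obtain ⟨r, hr, hr'⟩ := ih
      have hS : ((insert i s : Finset ι) : Set ι)ᶜ = (s : Set ι)ᶜ \ {i} := by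
        ext l; simp [and_comm]
      refine ⟨Function.update r i fun w => F (s : Set ι)ᶜ w / F ((s : Set ι)ᶜ \ {i}) w, ?_, ?_⟩
      · intro l hl
        rcases Finset.mem_insert.1 hl with rfl | hl
        · simp only [Function.update_self]
          exact integral_mul_condExp_div_condExp hle hind (by simpa using hi) hg hC
            (Real.continuous_exp.comp_stronglyMeasurable (hhm l)) (hhe l)
        · rw [Function.update_of_ne (ne_of_mem_of_not_mem hl hi)]
          exact hr l hl
      · filter_upwards [hr', condExp_exp_mem_Icc (sigmaOn_le hle (s : Set ι)ᶜ) hg hC,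
          condExp_exp_mem_Icc (sigmaOn_le hle ((s : Set ι)ᶜ \ {i})) hg hC] with w a1 a2 a3
        have p2 : 0 < F (s : Set ι)ᶜ w := (Real.exp_pos (-C)).trans_le a2.1
        have p3 : 0 < F ((s : Set ι)ᶜ \ {i}) w := (Real.exp_pos (-C)).trans_le a3.1
        rw [Finset.sum_insert hi, hS, Function.update_self]
        have e : ∀ l ∈ s, (Real.exp (g w) * (g w - h l w) - Real.exp (g w) + Real.exp (h l w) *
            (Function.update r i fun w => F (s : Set ι)ᶜ w / F ((s : Set ι)ᶜ \ {i}) w) l w) =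
            Real.exp (g w) * (g w - h l w) - Real.exp (g w) + Real.exp (h l w) * r l w :=
          fun l hl => by rw [Function.update_of_ne (ne_of_mem_of_not_mem hl hi)]
        rw [Finset.sum_congr rfl e]
        have y := exp_mul_le_young (g w) (h i w)
          (Real.log (F (s : Set ι)ᶜ w) - Real.log (F ((s : Set ι)ᶜ \ {i}) w))
        rw [Real.exp_sub, Real.exp_log p2, Real.exp_log p3] at y
        linarith
  obtain ⟨r, hr, hr'⟩ := key Finset.univ
  have hb : F ((Finset.univ : Finset ι) : Set ι)ᶜ = fun _ => ∫ w, Real.exp (g w) ∂μ := by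
    rw [hFdef]
    have hb : sigmaOn 𝓕 ((Finset.univ : Finset ι) : Set ι)ᶜ = ⊥ := by simp [sigmaOn]
    simp only [hb]
    exact condExp_bot _
  rw [hb] at hr'
  have hL : ∫ w, Real.exp (g w) * (g w - Real.log (∫ w, Real.exp (g w) ∂μ)) ∂μ =
      ∫ w, Real.exp (g w) * g w ∂μ -
        (∫ w, Real.exp (g w) ∂μ) * Real.log (∫ w, Real.exp (g w) ∂μ) := by
    simp only [mul_sub]
    rw [integral_sub hfg (hfi.mul_const _), integral_mul_const]
  have hsum : ∀ i ∈ Finset.univ, Integrable (fun w => Real.exp (g w) * (g w - h i w) -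
      Real.exp (g w) + Real.exp (h i w) * r i w) μ := fun i hi => (hfh i).add (hr i hi).1
  rw [← hL]
  refine (integral_mono_ae ?_ ?_ hr').trans_eq ?_
  · simp only [mul_sub]
    exact hfg.sub (hfi.mul_const _)
  · exact integrable_finsetSum _ hsum
  · rw [integral_finsetSum _ hsum]
    refine Finset.sum_congr rfl fun i hi => ?_
    rw [integral_add (hfh i) (hr i hi).1, integral_add (hfh i) (hhe i), (hr i hi).2]

end Product

/-! ### Removal of the lower bound by truncation. -/

section Entropy

open Filter Topology

variable {Ω ι : Type*} {m₀ : MeasurableSpace Ω} {μ : Measure Ω} [IsProbabilityMeasure μ]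
  {𝓕 : ι → MeasurableSpace Ω}

lemma eventually_max_neg_natCast_eq (x : ℝ) : ∀ᶠ N : ℕ in atTop, max x (-(N : ℝ)) = x := by
  filter_upwards [eventually_ge_atTop ⌈-x⌉₊] with N hN
  exact max_eq_left (by linarith [Nat.ceil_le.1 hN])

lemma abs_max_neg_natCast_le (x : ℝ) (N : ℕ) : |max x (-(N : ℝ))| ≤ |x| := by
  have hN : (0 : ℝ) ≤ N := N.cast_nonneg
  rcases le_total x (-(N : ℝ)) with h | h
  · rw [max_eq_right h, abs_neg, abs_of_nonneg hN, abs_of_nonpos (by linarith)]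
    linarith
  · rw [max_eq_left h]

/-- Modified logarithmic Sobolev inequality for functions of independent σ-algebras that are
bounded from above. -/
theorem entropy_exp_le [Fintype ι] (hle : ∀ i, 𝓕 i ≤ m₀) (hind : iIndep 𝓕 μ)
    {g : Ω → ℝ} (hgm : StronglyMeasurable[sigmaOn 𝓕 Set.univ] g) (hgi : Integrable g μ) {C : ℝ}
    (hC : ∀ᵐ w ∂μ, g w ≤ C) {h : ι → Ω → ℝ}
    (hhm : ∀ i, StronglyMeasurable[sigmaOn 𝓕 {i}ᶜ] (h i)) (hhi : ∀ i, Integrable (h i) μ)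
    (hhe : ∀ i, Integrable (fun w => Real.exp (h i w)) μ) :
    ∫ w, Real.exp (g w) * g w ∂μ -
        (∫ w, Real.exp (g w) ∂μ) * Real.log (∫ w, Real.exp (g w) ∂μ) ≤
      ∑ i, ∫ w, (Real.exp (g w) * (g w - h i w) - Real.exp (g w) + Real.exp (h i w)) ∂μ := by
  -- Only `g` is truncated. The `h i` need not be adapted, since the bounded case allows any
  -- functions that ignore coordinate `i`, subject to integrability.
  set G : ℕ → Ω → ℝ := fun N w => max (g w) (-(N : ℝ)) with hG
  have hGm : ∀ N, StronglyMeasurable[sigmaOn 𝓕 Set.univ] (G N) := fun N =>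
    (continuous_id.max continuous_const).comp_stronglyMeasurable hgm
  have hGms : ∀ N, AEStronglyMeasurable (G N) μ := fun N =>
    ((hGm N).mono (sigmaOn_le hle _)).aestronglyMeasurable
  have hGes : ∀ N, AEStronglyMeasurable (fun w => Real.exp (G N w)) μ := fun N =>
    Real.continuous_exp.comp_aestronglyMeasurable (hGms N)
  have hGe : ∀ N w, g w ≤ C → Real.exp (G N w) ≤ Real.exp |C| := fun N w hw =>
    Real.exp_le_exp.2 (max_le (hw.trans (le_abs_self C))
      ((neg_nonpos.2 N.cast_nonneg).trans (abs_nonneg C)))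
  have hlim : ∀ w, ∀ᶠ N in atTop, G N w = g w := fun w => eventually_max_neg_natCast_eq (g w)
  have l1 : Tendsto (fun N => ∫ w, Real.exp (G N w) ∂μ) atTop (𝓝 (∫ w, Real.exp (g w) ∂μ)) := by
    refine tendsto_integral_of_dominated_convergence (fun _ => Real.exp |C|) hGes
      (integrable_const _) (fun N => ?_) (ae_of_all _ fun w => ?_)
    · filter_upwards [hC] with w hw
      rw [Real.norm_eq_abs, Real.abs_exp]
      exact hGe N w hw
    · exact tendsto_const_nhds.congr' ((hlim w).mono fun N hN => by simp only [hN])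
  have l2 : Tendsto (fun N => ∫ w, Real.exp (G N w) * G N w ∂μ) atTop
      (𝓝 (∫ w, Real.exp (g w) * g w ∂μ)) := by
    refine tendsto_integral_of_dominated_convergence (fun w => Real.exp |C| * |g w|)
      (fun N => (hGes N).mul (hGms N)) (hgi.abs.const_mul _) (fun N => ?_) (ae_of_all _ fun w => ?_)
    · filter_upwards [hC] with w hw
      rw [norm_mul, Real.norm_eq_abs, Real.abs_exp, Real.norm_eq_abs]
      exact mul_le_mul (hGe N w hw) (abs_max_neg_natCast_le _ _) (abs_nonneg _) (Real.exp_pos _).le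
    · exact tendsto_const_nhds.congr' ((hlim w).mono fun N hN => by simp only [hN])
  have l3 : ∀ i, Tendsto (fun N => ∫ w, (Real.exp (G N w) * (G N w - h i w) - Real.exp (G N w) +
        Real.exp (h i w)) ∂μ) atTop
      (𝓝 (∫ w, (Real.exp (g w) * (g w - h i w) - Real.exp (g w) + Real.exp (h i w)) ∂μ)) := by
    intro i
    refine tendsto_integral_of_dominated_convergence
      (fun w => Real.exp |C| * (|g w| + |h i w|) + Real.exp |C| + Real.exp (h i w))
      (fun N => (((hGes N).mul ((hGms N).sub (hhi i).1)).sub (hGes N)).add (hhe i).1)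
      ((((hgi.abs.add (hhi i).abs).const_mul _).add (integrable_const _)).add (hhe i))
      (fun N => ?_) (ae_of_all _ fun w => ?_)
    · filter_upwards [hC] with w hw
      have e := hGe N w hw
      have e1 : |Real.exp (G N w) * (G N w - h i w)| ≤ Real.exp |C| * (|g w| + |h i w|) := by
        rw [abs_mul, Real.abs_exp]
        exact mul_le_mul e ((abs_sub _ _).trans (add_le_add (abs_max_neg_natCast_le _ _) le_rfl))
          (abs_nonneg _) (Real.exp_pos _).le
      rw [Real.norm_eq_abs]
      refine (abs_add_le _ _).trans (add_le_add ((abs_sub _ _).trans (add_le_add e1 ?_)) ?_)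
      · rwa [Real.abs_exp]
      · rw [Real.abs_exp]
    · exact tendsto_const_nhds.congr' ((hlim w).mono fun N hN => by simp only [hN])
  have hei : Integrable (fun w => Real.exp (g w)) μ := by
    refine Integrable.of_bound (Real.continuous_exp.comp_aestronglyMeasurable hgi.1) (Real.exp C) ?_
    filter_upwards [hC] with w hw
    rw [Real.norm_eq_abs, Real.abs_exp]
    exact Real.exp_le_exp.2 hw
  have hpos : 0 < ∫ w, Real.exp (g w) ∂μ := integral_exp_pos hei
  refine le_of_tendsto_of_tendsto' (l2.sub (l1.mul (l1.log hpos.ne')))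
    (tendsto_finsetSum _ fun i _ => l3 i) fun N => ?_
  refine entropy_exp_le_of_bounded hle hind (hGm N) (C := |C| + N) ?_ hhm hhi hhe
  filter_upwards [hC] with w hw
  have hN : (0 : ℝ) ≤ N := N.cast_nonneg
  refine abs_le.2 ⟨?_, max_le ?_ ?_⟩
  · exact le_trans (by linarith [abs_nonneg C]) (le_max_right _ _)
  · linarith [le_abs_self C]
  · linarith [abs_nonneg C]

end Entropy

/-! ### The entropy method for one sub-additive function. -/

/-- `Z` is a function of independent σ-algebras `𝓕 i`, and the functions `Zd i` of all of them but
the `i`-th make it sub-additive with increments at most one; the increments are bounded from below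
by random variables `Y i ≤ b` with non-negative conditional means and with conditional second
moments that add up to at most `s`. -/
structure SubadditiveAssumption {Ω ι : Type*} [Fintype ι] {m₀ : MeasurableSpace Ω} (μ : Measure Ω)
    (𝓕 : ι → MeasurableSpace Ω) (Z : Ω → ℝ) (Zd Y : ι → Ω → ℝ) (b s : ℝ) : Prop where
  le : ∀ i, 𝓕 i ≤ m₀
  indep : iIndep 𝓕 μ
  stronglyMeasurable_Z : StronglyMeasurable[sigmaOn 𝓕 Set.univ] Z
  stronglyMeasurable_Zd : ∀ i, StronglyMeasurable[sigmaOn 𝓕 {i}ᶜ] (Zd i)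
  integrable_Z : Integrable Z μ
  memLp_Y : ∀ i, MemLp (Y i) 2 μ
  Y_le_sub : ∀ i, ∀ᵐ w ∂μ, Y i w ≤ Z w - Zd i w
  sub_le_one : ∀ i, ∀ᵐ w ∂μ, Z w - Zd i w ≤ 1
  condExp_nonneg : ∀ i, ∀ᵐ w ∂μ, 0 ≤ (μ[Y i | sigmaOn 𝓕 {i}ᶜ]) w
  Y_le : ∀ i, ∀ᵐ w ∂μ, Y i w ≤ b
  sum_condExp_sq_le : ∀ᵐ w ∂μ, ∑ i, (μ[fun w' => Y i w' ^ 2 | sigmaOn 𝓕 {i}ᶜ]) w ≤ s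
  sum_sub_le : ∀ w, ∑ i, (Z w - Zd i w) ≤ Z w
  b_nonneg : 0 ≤ b

namespace SubadditiveAssumption

variable {Ω ι : Type*} [Fintype ι] {m₀ : MeasurableSpace Ω} {μ : Measure Ω}
  {𝓕 : ι → MeasurableSpace Ω} {Z : Ω → ℝ} {Zd Y : ι → Ω → ℝ} {b s : ℝ}

lemma aestronglyMeasurable_exp (h : SubadditiveAssumption μ 𝓕 Z Zd Y b s) (l : ℝ) :
    AEStronglyMeasurable (fun w => Real.exp (l * Z w)) μ :=
  Real.continuous_exp.comp_aestronglyMeasurable (h.integrable_Z.1.const_mul l)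

lemma stronglyMeasurable_exp_Zd (h : SubadditiveAssumption μ 𝓕 Z Zd Y b s) (l : ℝ) (i : ι) :
    StronglyMeasurable[sigmaOn 𝓕 {i}ᶜ] (fun w => Real.exp (l * Zd i w)) :=
  Real.continuous_exp.comp_stronglyMeasurable ((h.stronglyMeasurable_Zd i).const_mul l)

lemma condExp_sq_mem_Icc (h : SubadditiveAssumption μ 𝓕 Z Zd Y b s) :
    ∀ᵐ w ∂μ, ∀ i, 0 ≤ (μ[fun w' => Y i w' ^ 2 | sigmaOn 𝓕 {i}ᶜ]) w ∧
      (μ[fun w' => Y i w' ^ 2 | sigmaOn 𝓕 {i}ᶜ]) w ≤ s := by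
  have h1 : ∀ᵐ w ∂μ, ∀ i, 0 ≤ (μ[fun w' => Y i w' ^ 2 | sigmaOn 𝓕 {i}ᶜ]) w :=
    ae_all_iff.2 fun i => MeasureTheory.condExp_nonneg (ae_of_all _ fun w => sq_nonneg (Y i w))
  filter_upwards [h1, h.sum_condExp_sq_le] with w a1 a2 i
  exact ⟨a1 i, (Finset.single_le_sum (fun l _ => a1 l) (Finset.mem_univ i)).trans a2⟩

lemma integrable_Y_sq (h : SubadditiveAssumption μ 𝓕 Z Zd Y b s) (i : ι) :
    Integrable (fun w => Y i w ^ 2) μ := (h.memLp_Y i).integrable_sq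

lemma aestronglyMeasurable_exp_Zd (h : SubadditiveAssumption μ 𝓕 Z Zd Y b s) (l : ℝ) (i : ι) :
    AEStronglyMeasurable (fun w => Real.exp (l * Zd i w)) μ :=
  ((h.stronglyMeasurable_exp_Zd l i).mono (sigmaOn_le h.le _)).aestronglyMeasurable

variable [IsProbabilityMeasure μ]

lemma integrable_Y (h : SubadditiveAssumption μ 𝓕 Z Zd Y b s) (i : ι) : Integrable (Y i) μ :=
  (h.memLp_Y i).integrable (by norm_num)

lemma integrable_Zd (h : SubadditiveAssumption μ 𝓕 Z Zd Y b s) (i : ι) :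
    Integrable (Zd i) μ := by
  refine Integrable.mono' ((h.integrable_Z.abs.add (integrable_const 1)).add (h.integrable_Y i).abs)
    ((h.stronglyMeasurable_Zd i).mono (sigmaOn_le h.le _)).aestronglyMeasurable ?_
  filter_upwards [h.Y_le_sub i, h.sub_le_one i] with w h1 h2
  simp only [Pi.add_apply, Real.norm_eq_abs]
  rw [abs_le]
  constructor <;>
  linarith [le_abs_self (Z w), neg_abs_le (Z w), abs_nonneg (Y i w), neg_abs_le (Y i w)]

lemma integral_nonneg (h : SubadditiveAssumption μ 𝓕 Z Zd Y b s) : 0 ≤ ∫ w, Z w ∂μ := by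
  have h1 : ∀ i, 0 ≤ ∫ w, (Z w - Zd i w) ∂μ := fun i => by
    have : 0 ≤ ∫ w, Y i w ∂μ := by
      rw [← integral_condExp (sigmaOn_le h.le {i}ᶜ)]
      exact integral_nonneg_of_ae (h.condExp_nonneg i)
    exact this.trans (integral_mono_ae (h.integrable_Y i)
      (h.integrable_Z.sub (h.integrable_Zd i)) (h.Y_le_sub i))
  have hi : ∀ i ∈ Finset.univ, Integrable (fun w => Z w - Zd i w) μ := fun i _ =>
    h.integrable_Z.sub (h.integrable_Zd i)
  calc 0 ≤ ∑ i, ∫ w, (Z w - Zd i w) ∂μ := Finset.sum_nonneg fun i _ => h1 i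
    _ = ∫ w, ∑ i, (Z w - Zd i w) ∂μ := (integral_finsetSum _ hi).symm
    _ ≤ _ := integral_mono (integrable_finsetSum _ hi) h.integrable_Z h.sum_sub_le

lemma nonneg_s (h : SubadditiveAssumption μ 𝓕 Z Zd Y b s) : 0 ≤ s := by
  obtain ⟨w, h1, h2⟩ := (h.condExp_sq_mem_Icc.and h.sum_condExp_sq_le).exists
  exact (Finset.sum_nonneg fun i _ => (h1 i).1).trans h2

lemma Zd_le_condExp (h : SubadditiveAssumption μ 𝓕 Z Zd Y b s) (i : ι) :
    ∀ᵐ w ∂μ, Zd i w ≤ (μ[Z | sigmaOn 𝓕 {i}ᶜ]) w := by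
  have h1 := condExp_mono (m := sigmaOn 𝓕 {i}ᶜ) (h.integrable_Y i)
    (h.integrable_Z.sub (h.integrable_Zd i)) (h.Y_le_sub i)
  have h2 := condExp_sub h.integrable_Z (h.integrable_Zd i) (sigmaOn 𝓕 {i}ᶜ)
  rw [condExp_of_stronglyMeasurable (sigmaOn_le h.le _) (h.stronglyMeasurable_Zd i)
    (h.integrable_Zd i)] at h2
  filter_upwards [h1, h2, h.condExp_nonneg i] with w a1 a2 a3
  rw [a2, Pi.sub_apply] at a1
  linarith

/-- Only integrability of `Z` is assumed; this almost sure upper bound supplies the exponential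
moments for l ≥ 0. -/
lemma Z_le (h : SubadditiveAssumption μ 𝓕 Z Zd Y b s) :
    ∀ᵐ w ∂μ, Z w ≤ Fintype.card ι + ∫ w', Z w' ∂μ := by
  refine ae_le_card_add_integral h.le h.indep h.stronglyMeasurable_Z h.integrable_Z fun i => ?_
  filter_upwards [h.Zd_le_condExp i, h.sub_le_one i] with w h1 h2
  linarith

lemma Zd_le (h : SubadditiveAssumption μ 𝓕 Z Zd Y b s) (i : ι) :
    ∀ᵐ w ∂μ, Zd i w ≤ Fintype.card ι + ∫ w', Z w' ∂μ := by
  have h1 := condExp_mono (m := sigmaOn 𝓕 {i}ᶜ) h.integrable_Z (integrable_const _) h.Z_le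
  rw [condExp_const (sigmaOn_le h.le _)] at h1
  filter_upwards [h.Zd_le_condExp i, h1] with w a1 a2
  exact a1.trans a2

lemma norm_exp_mul_le (h : SubadditiveAssumption μ 𝓕 Z Zd Y b s) {l : ℝ} (hl : 0 ≤ l) :
    ∀ᵐ w ∂μ, ‖Real.exp (l * Z w)‖ ≤ Real.exp (l * (Fintype.card ι + ∫ w', Z w' ∂μ)) := by
  filter_upwards [h.Z_le] with w hw
  rw [Real.norm_eq_abs, Real.abs_exp]
  gcongr

lemma norm_exp_mul_Zd_le (h : SubadditiveAssumption μ 𝓕 Z Zd Y b s) {l : ℝ} (hl : 0 ≤ l) (i : ι) :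
    ∀ᵐ w ∂μ, ‖Real.exp (l * Zd i w)‖ ≤ Real.exp (l * (Fintype.card ι + ∫ w', Z w' ∂μ)) := by
  filter_upwards [h.Zd_le i] with w hw
  rw [Real.norm_eq_abs, Real.abs_exp]
  gcongr

lemma integrable_exp (h : SubadditiveAssumption μ 𝓕 Z Zd Y b s) {l : ℝ} (hl : 0 ≤ l) :
    Integrable (fun w => Real.exp (l * Z w)) μ :=
  Integrable.of_bound (h.aestronglyMeasurable_exp l) _ (h.norm_exp_mul_le hl)

lemma integrable_exp_Zd (h : SubadditiveAssumption μ 𝓕 Z Zd Y b s) {l : ℝ} (hl : 0 ≤ l) (i : ι) :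
    Integrable (fun w => Real.exp (l * Zd i w)) μ :=
  Integrable.of_bound (h.aestronglyMeasurable_exp_Zd l i) _ (h.norm_exp_mul_Zd_le hl i)

/-- Condition e^{lZ} ≥ e^{l Zd}(1 + lY) on the other coordinates: `Zd i` is known and Y has
non-negative conditional mean. -/
lemma exp_Zd_le_condExp (h : SubadditiveAssumption μ 𝓕 Z Zd Y b s) {l : ℝ} (hl : 0 ≤ l) (i : ι) :
    ∀ᵐ w ∂μ, Real.exp (l * Zd i w) ≤
      (μ[fun w => Real.exp (l * Z w) | sigmaOn 𝓕 {i}ᶜ]) w := by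
  have hYl : Integrable (fun w => 1 + l * Y i w) μ :=
    (integrable_const 1).add ((h.integrable_Y i).const_mul l)
  have hi : Integrable (fun w => Real.exp (l * Zd i w) * (1 + l * Y i w)) μ :=
    hYl.bdd_mul (h.aestronglyMeasurable_exp_Zd l i) (h.norm_exp_mul_Zd_le hl i)
  have h1 := condExp_mono (m := sigmaOn 𝓕 {i}ᶜ) hi (h.integrable_exp hl) (by
    filter_upwards [h.Y_le_sub i] with w hw
    have e1 : Real.exp (l * Z w) = Real.exp (l * Zd i w) * Real.exp (l * (Z w - Zd i w)) := by
      rw [← Real.exp_add]; ring_nf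
    rw [e1]
    have e2 := Real.add_one_le_exp (l * (Z w - Zd i w))
    have e3 := mul_le_mul_of_nonneg_left hw hl
    exact mul_le_mul_of_nonneg_left (by linarith) (Real.exp_pos _).le)
  have h2 := condExp_mul_of_stronglyMeasurable_left (μ := μ) (h.stronglyMeasurable_exp_Zd l i)
    (g := fun w => 1 + l * Y i w) hi hYl
  have h3 := condExp_add (μ := μ) (integrable_const (1 : ℝ)) ((h.integrable_Y i).const_mul l)
    (sigmaOn 𝓕 {i}ᶜ)
  have h4 := condExp_smul (μ := μ) l (Y i) (sigmaOn 𝓕 {i}ᶜ)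
  rw [condExp_const (sigmaOn_le h.le _)] at h3
  filter_upwards [h1, h2, h3, h4, h.condExp_nonneg i] with w a1 a2 a3 a4 a5
  refine le_trans ?_ (a2.symm.le.trans a1)
  have a3' : (μ[fun w => 1 + l * Y i w | sigmaOn 𝓕 {i}ᶜ]) w =
      1 + l * (μ[Y i | sigmaOn 𝓕 {i}ᶜ]) w := by
    refine Eq.trans a3 ?_
    rw [Pi.add_apply]
    congr 1
  rw [Pi.mul_apply, a3']
  have := mul_nonneg hl a5
  exact le_mul_of_one_le_right (Real.exp_pos _).le (by linarith)

lemma integrable_exp_mul_condExp_sq (h : SubadditiveAssumption μ 𝓕 Z Zd Y b s) {l : ℝ}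
    (hl : 0 ≤ l) (i : ι) :
    Integrable (fun w => Real.exp (l * Z w) * (μ[fun w' => Y i w' ^ 2 | sigmaOn 𝓕 {i}ᶜ]) w) μ :=
  integrable_condExp.bdd_mul (h.aestronglyMeasurable_exp l) (h.norm_exp_mul_le hl)

/-- The linear term has a favourable sign and is dropped. In the quadratic term conditioning
replaces Y² by its conditional mean, after which `exp_Zd_le_condExp` trades `Zd i` for `Z`, so that
the sum over `i` can be taken under one weight. -/
lemma integral_exp_Zd_mul_le (h : SubadditiveAssumption μ 𝓕 Z Zd Y b s) {l a : ℝ} (hl : 0 ≤ l)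
    (ha : 0 ≤ a) (i : ι) :
    ∫ w, Real.exp (l * Zd i w) * (a * Y i w ^ 2 - Y i w) ∂μ ≤
      a * ∫ w, Real.exp (l * Z w) * (μ[fun w' => Y i w' ^ 2 | sigmaOn 𝓕 {i}ᶜ]) w ∂μ := by
  set q := μ[fun w' => Y i w' ^ 2 | sigmaOn 𝓕 {i}ᶜ] with hq
  have hqi : Integrable q μ := integrable_condExp
  have hm := sigmaOn_le h.le {i}ᶜ
  have hint1 : Integrable (fun w => Real.exp (l * Zd i w) * Y i w ^ 2) μ :=
    (h.integrable_Y_sq i).bdd_mul (h.aestronglyMeasurable_exp_Zd l i) (h.norm_exp_mul_Zd_le hl i)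
  have hint2 : Integrable (fun w => Real.exp (l * Zd i w) * Y i w) μ :=
    (h.integrable_Y i).bdd_mul (h.aestronglyMeasurable_exp_Zd l i) (h.norm_exp_mul_Zd_le hl i)
  have hint3 : Integrable (fun w => Real.exp (l * Zd i w) * q w) μ :=
    hqi.bdd_mul (h.aestronglyMeasurable_exp_Zd l i) (h.norm_exp_mul_Zd_le hl i)
  have hint4 : Integrable (fun w => Real.exp (l * Z w) * q w) μ :=
    h.integrable_exp_mul_condExp_sq hl i
  have e1 : ∫ w, Real.exp (l * Zd i w) * Y i w ^ 2 ∂μ =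
      ∫ w, Real.exp (l * Zd i w) * q w ∂μ := by
    rw [← integral_condExp hm]
    exact integral_congr_ae (condExp_mul_of_stronglyMeasurable_left
      (h.stronglyMeasurable_exp_Zd l i) hint1 (h.integrable_Y_sq i))
  have e2 : 0 ≤ ∫ w, Real.exp (l * Zd i w) * Y i w ∂μ := by
    rw [← integral_condExp hm]
    refine integral_nonneg_of_ae ?_
    filter_upwards [h.condExp_nonneg i, condExp_mul_of_stronglyMeasurable_left
      (h.stronglyMeasurable_exp_Zd l i) hint2 (h.integrable_Y i)] with w a1 a2
    refine le_of_le_of_eq ?_ a2.symm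
    exact mul_nonneg (Real.exp_pos _).le a1
  have e3 : ∫ w, Real.exp (l * Z w) * q w ∂μ =
      ∫ w, (μ[fun w => Real.exp (l * Z w) | sigmaOn 𝓕 {i}ᶜ]) w * q w ∂μ := by
    rw [← integral_condExp hm]
    exact integral_congr_ae (condExp_mul_of_stronglyMeasurable_right
      stronglyMeasurable_condExp hint4 (h.integrable_exp hl))
  have hint5 : Integrable (fun w =>
      (μ[fun w => Real.exp (l * Z w) | sigmaOn 𝓕 {i}ᶜ]) w * q w) μ :=
    (integrable_condExp (m := sigmaOn 𝓕 {i}ᶜ)).congr (condExp_mul_of_stronglyMeasurable_right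
      stronglyMeasurable_condExp hint4 (h.integrable_exp hl))
  have e4 : ∫ w, Real.exp (l * Zd i w) * q w ∂μ ≤ ∫ w, Real.exp (l * Z w) * q w ∂μ := by
    rw [e3]
    refine integral_mono_ae hint3 hint5 ?_
    filter_upwards [h.exp_Zd_le_condExp hl i, h.condExp_sq_mem_Icc] with w a1 a2
    exact mul_le_mul_of_nonneg_right a1 (a2 i).1
  calc ∫ w, Real.exp (l * Zd i w) * (a * Y i w ^ 2 - Y i w) ∂μ
      = ∫ w, (a * (Real.exp (l * Zd i w) * Y i w ^ 2) - Real.exp (l * Zd i w) * Y i w) ∂μ := by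
        congr 1; ext w; ring
    _ = a * ∫ w, Real.exp (l * Zd i w) * Y i w ^ 2 ∂μ -
        ∫ w, Real.exp (l * Zd i w) * Y i w ∂μ := by
        rw [integral_sub (hint1.const_mul a) hint2, integral_const_mul]
    _ ≤ a * ∫ w, Real.exp (l * Zd i w) * Y i w ^ 2 ∂μ := by linarith
    _ ≤ _ := by rw [e1]; exact mul_le_mul_of_nonneg_left e4 ha

/-- The differential inequality of the moment generating function. -/
theorem mul_integral_sub_le (h : SubadditiveAssumption μ 𝓕 Z Zd Y b s) {l : ℝ} (hl : 0 < l) :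
    l * ∫ w, Z w * Real.exp (l * Z w) ∂μ - mgf Z μ l * Real.log (mgf Z μ l) ≤
      entropyTheta l / (Real.exp l - 1 + (1 + b)⁻¹) *
        (∫ w, Z w * Real.exp (l * Z w) ∂μ + (1 + b)⁻¹ * s * mgf Z μ l) := by
  have hb := h.b_nonneg
  set a := (1 + b)⁻¹ with ha
  have ha0 : 0 < a := by positivity
  set c := entropyTheta l / (Real.exp l - 1 + a) with hc
  have hc0 : 0 ≤ c := div_nonneg (entropyTheta_nonneg l)
    (by linarith [Real.add_one_le_exp l])
  have hexp := h.integrable_exp hl.le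
  have hZe : Integrable (fun w => Z w * Real.exp (l * Z w)) μ :=
    h.integrable_Z.mul_bdd (h.aestronglyMeasurable_exp l) (h.norm_exp_mul_le hl.le)
  have hXe : ∀ i, Integrable (fun w => (Z w - Zd i w) * Real.exp (l * Z w)) μ := fun i =>
    (h.integrable_Z.sub (h.integrable_Zd i)).mul_bdd (h.aestronglyMeasurable_exp l)
      (h.norm_exp_mul_le hl.le)
  have hYe : ∀ i, Integrable (fun w => Real.exp (l * Zd i w) * (a * Y i w ^ 2 - Y i w)) μ :=
    fun i => (((h.integrable_Y_sq i).const_mul a).sub (h.integrable_Y i)).bdd_mul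
      (h.aestronglyMeasurable_exp_Zd l i) (h.norm_exp_mul_Zd_le hl.le i)
  have hent := entropy_exp_le h.le h.indep (h.stronglyMeasurable_Z.const_mul l)
    (h.integrable_Z.const_mul l) (C := l * (Fintype.card ι + ∫ w', Z w' ∂μ))
    (by filter_upwards [h.Z_le] with w hw; gcongr)
    (h := fun i w => l * Zd i w) (fun i => (h.stronglyMeasurable_Zd i).const_mul l)
    (fun i => (h.integrable_Zd i).const_mul l) (fun i => h.integrable_exp_Zd hl.le i)
  have e1 : ∫ w, Real.exp (l * Z w) * (l * Z w) ∂μ = l * ∫ w, Z w * Real.exp (l * Z w) ∂μ := by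
    rw [← integral_const_mul]; congr 1; ext w; ring
  rw [e1] at hent
  refine hent.trans ?_
  have hterm : ∀ i, ∫ w, (Real.exp (l * Z w) * (l * Z w - l * Zd i w) - Real.exp (l * Z w) +
        Real.exp (l * Zd i w)) ∂μ ≤ c * (∫ w, (Z w - Zd i w) * Real.exp (l * Z w) ∂μ +
        a * ∫ w, Real.exp (l * Z w) * (μ[fun w' => Y i w' ^ 2 | sigmaOn 𝓕 {i}ᶜ]) w ∂μ) := by
    intro i
    have hint : Integrable (fun w => Real.exp (l * Z w) * (l * Z w - l * Zd i w) -
        Real.exp (l * Z w) + Real.exp (l * Zd i w)) μ := by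
      refine (Integrable.sub ?_ hexp).add (h.integrable_exp_Zd hl.le i)
      refine ((hXe i).const_mul l).congr (ae_of_all _ fun w => ?_)
      ring
    calc _ ≤ ∫ w, c * ((Z w - Zd i w) * Real.exp (l * Z w) +
          Real.exp (l * Zd i w) * (a * Y i w ^ 2 - Y i w)) ∂μ := by
          refine integral_mono_ae hint (((hXe i).add (hYe i)).const_mul c) ?_
          filter_upwards [h.Y_le_sub i, h.sub_le_one i, h.Y_le i] with w a1 a2 a3
          have e1 : Real.exp (l * Z w) =
              Real.exp (l * Zd i w) * Real.exp (l * (Z w - Zd i w)) := by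
            rw [← Real.exp_add]; ring_nf
          have t1 := entropyTheta_mul_le_div_mul hl a2 ha0.le
          -- The choice a = 1/(1+b) is made here: x ≤ 1 and Y ≤ b give a(x + Y) ≤ 1, so x may be
          -- replaced by Y.
          have t2 := mul_sq_sub_le_of_add_le (a := a) a1 (by
            rw [ha, inv_mul_le_one₀ (by linarith)]; linarith)
          have p := Real.exp_pos (l * Zd i w)
          have t3 : entropyTheta (l * (Z w - Zd i w)) ≤ c * ((Z w - Zd i w) *
              Real.exp (l * (Z w - Zd i w)) + (a * Y i w ^ 2 - Y i w)) :=
            t1.trans (mul_le_mul_of_nonneg_left (by linarith) hc0)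
          have t4 := mul_le_mul_of_nonneg_left t3 p.le
          rw [e1]
          unfold entropyTheta at t4
          linarith
      _ = c * (∫ w, (Z w - Zd i w) * Real.exp (l * Z w) ∂μ +
          ∫ w, Real.exp (l * Zd i w) * (a * Y i w ^ 2 - Y i w) ∂μ) := by
          rw [integral_const_mul, integral_add (hXe i) (hYe i)]
      _ ≤ _ := by
          have := h.integral_exp_Zd_mul_le hl.le ha0.le i
          gcongr
  refine (Finset.sum_le_sum fun i _ => hterm i).trans ?_
  rw [← Finset.mul_sum, Finset.sum_add_distrib, ← Finset.mul_sum]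
  have s1 : ∑ i, ∫ w, (Z w - Zd i w) * Real.exp (l * Z w) ∂μ ≤
      ∫ w, Z w * Real.exp (l * Z w) ∂μ := by
    rw [← integral_finsetSum _ fun i _ => hXe i]
    refine integral_mono (integrable_finsetSum _ fun i _ => hXe i) hZe fun w => ?_
    simp only
    rw [← Finset.sum_mul]
    exact mul_le_mul_of_nonneg_right (h.sum_sub_le w) (Real.exp_pos _).le
  have s2 : ∑ i, ∫ w, Real.exp (l * Z w) * (μ[fun w' => Y i w' ^ 2 | sigmaOn 𝓕 {i}ᶜ]) w ∂μ ≤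
      s * mgf Z μ l := by
    rw [← integral_finsetSum _ fun i _ => h.integrable_exp_mul_condExp_sq hl.le i, mgf,
      ← integral_const_mul]
    refine integral_mono_ae
      (integrable_finsetSum _ fun i _ => h.integrable_exp_mul_condExp_sq hl.le i)
      (hexp.const_mul s) ?_
    filter_upwards [h.sum_condExp_sq_le] with w hw
    rw [← Finset.mul_sum, mul_comm s]
    exact mul_le_mul_of_nonneg_left hw (Real.exp_pos _).le
  rw [mul_assoc a s]
  gcongr

end SubadditiveAssumption

/-! ### Integration of the differential inequality. -/

lemma abs_exp_sub_one_le (x : ℝ) : |Real.exp x - 1| ≤ |x| * Real.exp (max x 0) := by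
  rcases le_total 0 x with h | h
  · rw [max_eq_left h, abs_of_nonneg h, abs_of_nonneg (sub_nonneg.2 (Real.one_le_exp h))]
    have h1 := Real.add_one_le_exp (-x)
    have h2 : Real.exp (-x) * Real.exp x = 1 := by rw [← Real.exp_add]; simp
    nlinarith [Real.exp_pos x]
  · rw [max_eq_right h, abs_of_nonpos h, abs_of_nonpos (sub_nonpos.2 (Real.exp_le_one_iff.2 h))]
    have h1 := Real.add_one_le_exp x
    simp only [Real.exp_zero]
    linarith

namespace SubadditiveAssumption

open Filter Topology

variable {Ω ι : Type*} [Fintype ι] {m₀ : MeasurableSpace Ω} {μ : Measure Ω}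
  [IsProbabilityMeasure μ] {𝓕 : ι → MeasurableSpace Ω} {Z : Ω → ℝ} {Zd Y : ι → Ω → ℝ} {b s : ℝ}

lemma hasDerivAt_mgf (h : SubadditiveAssumption μ 𝓕 Z Zd Y b s) {l : ℝ} (hl : 0 < l) :
    HasDerivAt (mgf Z μ) (∫ w, Z w * Real.exp (l * Z w) ∂μ) l := by
  refine ProbabilityTheory.hasDerivAt_mgf (mem_interior.2 ⟨Set.Ioi 0, fun t ht => ?_, isOpen_Ioi, hl⟩)
  exact h.integrable_exp (le_of_lt ht)

lemma mgf_Z_pos (h : SubadditiveAssumption μ 𝓕 Z Zd Y b s) {l : ℝ} (hl : 0 ≤ l) :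
    0 < mgf Z μ l := ProbabilityTheory.mgf_pos (h.integrable_exp hl)

/-- Exponential moments for negative `l` are not available, so only the right derivative at 0 is
taken, by dominated convergence. -/
lemma tendsto_mgf_sub_one_div (h : SubadditiveAssumption μ 𝓕 Z Zd Y b s) :
    Tendsto (fun l => (mgf Z μ l - 1) / l) (𝓝[>] 0) (𝓝 (∫ w, Z w ∂μ)) := by
  set B := |(Fintype.card ι + ∫ w', Z w' ∂μ : ℝ)| with hB
  have hI : Set.Ioo (0 : ℝ) 1 ∈ 𝓝[>] (0 : ℝ) := Ioo_mem_nhdsGT one_pos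
  have key : Tendsto (fun l => ∫ w, (Real.exp (l * Z w) - 1) / l ∂μ) (𝓝[>] 0)
      (𝓝 (∫ w, Z w ∂μ)) := by
    refine tendsto_integral_filter_of_dominated_convergence (fun w => |Z w| * Real.exp B) ?_ ?_
      (h.integrable_Z.abs.mul_const _) (ae_of_all _ fun w => ?_)
    · exact Eventually.of_forall fun l =>
        (((h.aestronglyMeasurable_exp l).aemeasurable.sub_const 1).div_const l).aestronglyMeasurable
    · filter_upwards [hI] with l hl
      filter_upwards [h.Z_le] with w hw
      have hl0 := hl.1
      rw [norm_div, Real.norm_eq_abs, Real.norm_eq_abs, abs_of_pos hl0, div_le_iff₀ hl0]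
      refine (abs_exp_sub_one_le _).trans ?_
      rw [abs_mul, abs_of_pos hl0]
      have h1 : max (l * Z w) 0 ≤ B := by
        refine max_le ?_ (abs_nonneg _)
        rcases le_total 0 (Z w) with h0 | h0
        · have : l * Z w ≤ 1 * Z w := mul_le_mul_of_nonneg_right hl.2.le h0
          linarith [le_abs_self (Fintype.card ι + ∫ w', Z w' ∂μ : ℝ)]
        · exact (mul_nonpos_of_nonneg_of_nonpos hl0.le h0).trans (abs_nonneg _)
      calc l * |Z w| * Real.exp (max (l * Z w) 0) ≤ l * |Z w| * Real.exp B := by gcongr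
        _ = _ := by ring
    · have hd : HasDerivAt (fun l => Real.exp (l * Z w)) (Z w) 0 := by
        simpa using ((hasDerivAt_id (0 : ℝ)).mul_const (Z w)).exp
      refine (hd.tendsto_slope.mono_left (nhdsGT_le_nhdsNE 0)).congr fun l => ?_
      simp [slope_def_field]
  refine key.congr' ?_
  filter_upwards [self_mem_nhdsWithin] with l hl
  rw [integral_div, integral_sub (h.integrable_exp (le_of_lt hl)) (integrable_const _)]
  simp [mgf]

/-- Bennett-type bound of the moment generating function of a sub-additive function of independent
random variables. -/
theorem log_mgf_le (h : SubadditiveAssumption μ 𝓕 Z Zd Y b s) {l : ℝ} (hl : 0 < l) :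
    Real.log (mgf Z μ l) - l * ∫ w, Z w ∂μ ≤
      ((1 + b) * (∫ w, Z w ∂μ) + s) * bennettPsi l := by
  have hb := h.b_nonneg
  set M := ∫ w, Z w ∂μ with hM
  have hM0 : 0 ≤ M := h.integral_nonneg
  set v := (1 + b) * M + s with hv
  have hv0 : 0 ≤ v := add_nonneg (mul_nonneg (by linarith) hM0) h.nonneg_s
  set a := (1 + b)⁻¹ with ha
  have ha0 : 0 < a := by positivity
  have hav : a * v = M + a * s := by
    rw [hv, ha]; field_simp
  -- The integrating factor: N' = e^l − 1 + a and l N' − θ = N. With L the log-mgf, the differential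
  -- inequality becomes L'N − L N' ≤ a s θ. The function lM + vψ gives equality because a v = M + a
  -- s, so the difference `D` divided by `N` decreases.
  set N : ℝ → ℝ := fun l => Real.exp l - 1 - (1 - a) * l with hN
  have hNpos : ∀ l, 0 < l → a * l ≤ N l := fun l _ => by
    have := Real.add_one_le_exp l
    simp only [hN]; linarith
  have hNd : ∀ l, HasDerivAt N (Real.exp l - (1 - a)) l := fun l =>
    (((Real.hasDerivAt_exp l).sub_const 1).sub ((hasDerivAt_id l).const_mul (1 - a))).congr_deriv
      (by simp)
  set D : ℝ → ℝ := fun l => Real.log (mgf Z μ l) - l * M - v * bennettPsi l with hD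
  have hDd : ∀ l, 0 < l → HasDerivAt D ((∫ w, Z w * Real.exp (l * Z w) ∂μ) / mgf Z μ l - M -
      v * (Real.exp l - 1)) l := fun l hl =>
    ((((h.hasDerivAt_mgf hl).log (h.mgf_Z_pos hl.le).ne').sub
      ((hasDerivAt_id l).mul_const M)).sub ((hasDerivAt_bennettPsi l).const_mul v)).congr_deriv
      (by simp)
  have hquot : ∀ l, 0 < l → HasDerivAt (fun l => D l / N l)
      ((((∫ w, Z w * Real.exp (l * Z w) ∂μ) / mgf Z μ l - M - v * (Real.exp l - 1)) * N l -
        D l * (Real.exp l - (1 - a))) / N l ^ 2) l := fun l hl =>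
    (hDd l hl).div (hNd l) ((mul_pos ha0 hl).trans_le (hNpos l hl)).ne'
  have hanti : AntitoneOn (fun l => D l / N l) (Set.Ioi 0) := by
    refine antitoneOn_of_deriv_nonpos (convex_Ioi 0)
      (fun l hl => (hquot l hl).continuousAt.continuousWithinAt)
      (fun l hl => (hquot l (by simpa using hl)).differentiableAt.differentiableWithinAt)
      fun l hl => ?_
    rw [interior_Ioi, Set.mem_Ioi] at hl
    rw [(hquot l hl).deriv]
    refine div_nonpos_of_nonpos_of_nonneg ?_ (sq_nonneg _)
    have hF := h.mgf_Z_pos hl.le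
    have hdiff := h.mul_integral_sub_le hl
    rw [← ha] at hdiff
    set F := mgf Z μ l
    set p := (∫ w, Z w * Real.exp (l * Z w) ∂μ) / F with hp
    have hp' : ∫ w, Z w * Real.exp (l * Z w) ∂μ = p * F := (div_mul_cancel₀ _ hF.ne').symm
    rw [hp'] at hdiff
    have hn : 0 < Real.exp l - 1 + a := by linarith [Real.add_one_le_exp l]
    have h1 : l * p - Real.log F ≤ entropyTheta l / (Real.exp l - 1 + a) * (p + a * s) := by
      refine le_of_mul_le_mul_left ?_ hF
      linarith
    rw [div_mul_eq_mul_div, le_div_iff₀ hn] at h1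
    have h2 : D l = Real.log F - l * M - v * bennettPsi l := rfl
    have h3 : N l = Real.exp l - 1 - (1 - a) * l := rfl
    have h4 : entropyTheta l * (a * v) = entropyTheta l * (M + a * s) := by rw [hav]
    rw [h2, h3]
    unfold entropyTheta at h1 h4
    unfold bennettPsi
    linarith
  -- Initial condition: near 0 the quotient D/N is dominated by this expression, using log F ≤ F − 1
  -- and N(e) ≥ a e.
  have hlim : Tendsto (fun e => ((mgf Z μ e - 1) / e - M) / a) (𝓝[>] 0) (𝓝 0) := by
    simpa [← hM] using (h.tendsto_mgf_sub_one_div.sub_const M).div_const a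
  have hle : D l / N l ≤ 0 := by
    refine ge_of_tendsto hlim ?_
    filter_upwards [Ioo_mem_nhdsGT hl] with e he
    refine (hanti he.1 hl he.2.le).trans ?_
    have he0 := he.1
    have h1 : D e ≤ mgf Z μ e - 1 - e * M := by
      have := Real.log_le_sub_one_of_pos (h.mgf_Z_pos he0.le)
      have := mul_nonneg hv0 (bennettPsi_nonneg e)
      simp only [hD]; linarith
    have h2 : 0 ≤ mgf Z μ e - 1 - e * M := by
      have : ∫ w, (1 + e * Z w) ∂μ ≤ mgf Z μ e :=
        integral_mono ((integrable_const _).add (h.integrable_Z.const_mul e))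
          (h.integrable_exp he0.le) fun w => by
            simpa [add_comm] using Real.add_one_le_exp (e * Z w)
      rw [integral_add (integrable_const _) (h.integrable_Z.const_mul e),
        integral_const_mul] at this
      simp only [integral_const, probReal_univ, smul_eq_mul, mul_one] at this
      linarith
    have hae : 0 < a * e := mul_pos ha0 he0
    calc D e / N e ≤ (mgf Z μ e - 1 - e * M) / N e := by
          have := hae.trans_le (hNpos e he0)
          gcongr
      _ ≤ (mgf Z μ e - 1 - e * M) / (a * e) := div_le_div_of_nonneg_left h2 hae (hNpos e he0)
      _ = _ := by field_simp
  have hNl : 0 < N l := (mul_pos ha0 hl).trans_le (hNpos l hl)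
  have hDl : D l ≤ 0 := by
    by_contra hc
    exact absurd hle (not_le.2 (div_pos (not_le.1 hc) hNl))
  simp only [hD] at hDl
  linarith

/-- The centered moment generating function of a sub-additive function. -/
theorem integral_exp_sub_le (h : SubadditiveAssumption μ 𝓕 Z Zd Y b s) {l : ℝ} (hl : 0 ≤ l) :
    Integrable (fun w => Real.exp (l * (Z w - ∫ w', Z w' ∂μ))) μ ∧
      ∫ w, Real.exp (l * (Z w - ∫ w', Z w' ∂μ)) ∂μ ≤
        Real.exp (((1 + b) * (∫ w, Z w ∂μ) + s) * bennettPsi l) := by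
  have e : (fun w => Real.exp (l * (Z w - ∫ w', Z w' ∂μ))) =
      fun w => Real.exp (l * Z w) * Real.exp (-(l * ∫ w', Z w' ∂μ)) := by
    ext w; rw [← Real.exp_add]; ring_nf
  rw [e]
  refine ⟨(h.integrable_exp hl).mul_const _, ?_⟩
  rcases hl.eq_or_lt with rfl | hl
  · simp [bennettPsi]
  rw [integral_mul_const]
  have h1 := h.log_mgf_le hl
  have h2 : mgf Z μ l = Real.exp (Real.log (mgf Z μ l)) :=
    (Real.exp_log (h.mgf_Z_pos hl.le)).symm
  change mgf Z μ l * _ ≤ _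
  rw [h2, ← Real.exp_add]
  exact Real.exp_le_exp.2 (by linarith)

end SubadditiveAssumption

/-! ### The Bennett rate function φ. -/

section BennettFunction

lemma hasDerivAt_bennettPhi {x : ℝ} (hx : 0 ≤ x) :
    HasDerivAt bennettPhi (Real.log (1 + x)) x := by
  have h1 : HasDerivAt (fun x : ℝ => 1 + x) 1 x := (hasDerivAt_id x).const_add 1
  have hx1 : 1 + x ≠ 0 := by positivity
  refine ((h1.mul (h1.log hx1)).sub (hasDerivAt_id x)).congr_deriv ?_
  field_simp
  ring

lemma monotoneOn_bennettPhi : MonotoneOn bennettPhi (Set.Ici 0) := by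
  refine monotoneOn_of_deriv_nonneg (convex_Ici 0)
    (fun x hx => (hasDerivAt_bennettPhi hx).continuousAt.continuousWithinAt)
    (fun x hx => (hasDerivAt_bennettPhi
      (interior_subset hx)).differentiableAt.differentiableWithinAt) fun x hx => ?_
  have hx : 0 ≤ x := interior_subset hx
  rw [(hasDerivAt_bennettPhi hx).deriv]
  exact Real.log_nonneg (by linarith)

/-- The rational function is the one for which (1 + x) times it, minus x, equals x²/(2(1 + x/3)). -/
lemma div_le_log_one_add {x : ℝ} (hx : 0 ≤ x) :
    (6 * x + 5 * x ^ 2) / (6 + 8 * x + 2 * x ^ 2) ≤ Real.log (1 + x) := by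
  have hd : ∀ x : ℝ, 0 ≤ x → HasDerivAt
      (fun x => Real.log (1 + x) - (6 * x + 5 * x ^ 2) / (6 + 8 * x + 2 * x ^ 2))
      (4 * x ^ 3 / (6 + 8 * x + 2 * x ^ 2) ^ 2) x := fun x hx => by
    have h1 : HasDerivAt (fun x : ℝ => 1 + x) 1 x := (hasDerivAt_id x).const_add 1
    have hx1 : 1 + x ≠ 0 := by positivity
    have hx2 : 6 + 8 * x + 2 * x ^ 2 ≠ 0 := by positivity
    have hn : HasDerivAt (fun x : ℝ => 6 * x + 5 * x ^ 2) (6 + 10 * x) x :=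
      (((hasDerivAt_id x).const_mul 6).add ((hasDerivAt_pow 2 x).const_mul 5)).congr_deriv
        (by simp; ring)
    have hdn : HasDerivAt (fun x : ℝ => 6 + 8 * x + 2 * x ^ 2) (8 + 4 * x) x :=
      ((((hasDerivAt_id x).const_mul 8).const_add 6).add
        ((hasDerivAt_pow 2 x).const_mul 2)).congr_deriv (by simp; ring)
    refine ((h1.log hx1).sub (hn.div hdn hx2)).congr_deriv ?_
    field_simp
    ring
  have hmono : MonotoneOn
      (fun x => Real.log (1 + x) - (6 * x + 5 * x ^ 2) / (6 + 8 * x + 2 * x ^ 2))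
      (Set.Ici 0) := by
    refine monotoneOn_of_deriv_nonneg (convex_Ici 0)
      (fun x hx => (hd x hx).continuousAt.continuousWithinAt)
      (fun x hx => (hd x (interior_subset hx)).differentiableAt.differentiableWithinAt)
      fun x hx => ?_
    have hx : 0 ≤ x := interior_subset hx
    rw [(hd x hx).deriv]
    positivity
  have h := hmono Set.self_mem_Ici (Set.mem_Ici.2 hx) hx
  simp only [add_zero, Real.log_one, mul_zero, ne_eq, OfNat.ofNat_ne_zero, not_false_eq_true,
    zero_pow, zero_div, sub_zero] at h
  linarith

lemma sq_div_le_bennettPhi {x : ℝ} (hx : 0 ≤ x) :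
    x ^ 2 / (2 * (1 + x / 3)) ≤ bennettPhi x := by
  have h := mul_le_mul_of_nonneg_left (div_le_log_one_add hx) (by linarith : 0 ≤ 1 + x)
  unfold bennettPhi
  refine le_trans (le_of_eq ?_) (sub_le_sub_right h x)
  have h1 : 6 + 8 * x + 2 * x ^ 2 = 2 * (1 + x) * (3 + x) := by ring
  rw [h1]
  field_simp
  ring

end BennettFunction

/-! ### Dependent sums and Chernoff's bound. -/

section Combination

variable {Ω Q : Type*} [Fintype Q] {m₀ : MeasurableSpace Ω} {μ : Measure Ω}

/-- Bound of the moment generating function of a weighted sum of arbitrarily dependent random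
variables whose moment generating functions have bounds of Bennett type. -/
theorem integral_exp_sum_le {ω v M : Q → ℝ} {T : Q → Ω → ℝ} {U V : ℝ}
    (hω : ∀ q, 0 < ω q) (hM : ∀ q, 1 ≤ M q) (hU : U = ∑ q, ω q * M q) (hUpos : 0 < U)
    (hV : 0 ≤ V)
    (hv : ∀ q, v q ≤ V * M q ^ 2)
    (hT : ∀ q (l : ℝ), 0 ≤ l → Integrable (fun w => Real.exp (l * T q w)) μ ∧
      ∫ w, Real.exp (l * T q w) ∂μ ≤ Real.exp (v q * bennettPsi l)) {l : ℝ} (hl : 0 ≤ l) :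
    Integrable (fun w => Real.exp (l * ∑ q, ω q * T q w)) μ ∧
      ∫ w, Real.exp (l * ∑ q, ω q * T q w) ∂μ ≤ Real.exp (V * bennettPsi (l * U)) := by
  have hM0 : ∀ q, 0 < M q := fun q => one_pos.trans_le (hM q)
  -- Jensen weights, chosen so that l ω_q T_q = p_q · (lU/M_q) T_q; they sum to one by the
  -- definition of U.
  set p : Q → ℝ := fun q => ω q * M q / U with hp
  have hp0 : ∀ q, 0 ≤ p q := fun q => (div_pos (mul_pos (hω q) (hM0 q)) hUpos).le
  have hp1 : ∑ q, p q = 1 := by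
    rw [hp, ← Finset.sum_div, ← hU, div_self hUpos.ne']
  have hlq : ∀ q, 0 ≤ l * U / M q := fun q => div_nonneg (mul_nonneg hl hUpos.le) (hM0 q).le
  have hpt : ∀ w, Real.exp (l * ∑ q, ω q * T q w) ≤
      ∑ q, p q * Real.exp (l * U / M q * T q w) := fun w => by
    have h := convexOn_exp.map_sum_le (t := Finset.univ) (w := p)
      (p := fun q => l * U / M q * T q w) (fun q _ => hp0 q) hp1 (fun _ _ => Set.mem_univ _)
    simp only [smul_eq_mul] at h
    refine le_trans (le_of_eq ?_) h
    rw [Finset.mul_sum]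
    congr 1
    refine Finset.sum_congr rfl fun q _ => ?_
    have := (hM0 q).ne'
    simp only [hp]
    field_simp
  have hi : ∀ q ∈ Finset.univ, Integrable (fun w => p q * Real.exp (l * U / M q * T q w)) μ :=
    fun q _ => (hT q _ (hlq q)).1.const_mul _
  have hTm : ∀ q, AEMeasurable (T q) μ := fun q =>
    Real.aemeasurable_of_aemeasurable_exp_mul one_ne_zero (hT q 1 zero_le_one).1.1.aemeasurable
  have hint : Integrable (fun w => Real.exp (l * ∑ q, ω q * T q w)) μ := by
    refine Integrable.mono' (integrable_finsetSum _ hi) ?_ (ae_of_all _ fun w => ?_)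
    · exact (((Finset.aemeasurable_fun_sum _ fun q _ =>
        (hTm q).const_mul (ω q)).const_mul l).exp).aestronglyMeasurable
    · rw [Real.norm_eq_abs, Real.abs_exp]
      exact hpt w
  refine ⟨hint, ?_⟩
  calc _ ≤ ∫ w, ∑ q, p q * Real.exp (l * U / M q * T q w) ∂μ :=
        integral_mono hint (integrable_finsetSum _ hi) hpt
    _ = ∑ q, p q * ∫ w, Real.exp (l * U / M q * T q w) ∂μ := by
        rw [integral_finsetSum _ hi]
        exact Finset.sum_congr rfl fun q _ => integral_const_mul _ _
    _ ≤ ∑ q, p q * Real.exp (V * bennettPsi (l * U)) := by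
        refine Finset.sum_le_sum fun q _ => mul_le_mul_of_nonneg_left ?_ (hp0 q)
        refine (hT q _ (hlq q)).2.trans (Real.exp_le_exp.2 ?_)
        -- Contraction by 1/M_q gains M_q^{-2}, cancelling the factor M_q² in the bound of `v q`.
        have h1 := bennettPsi_mul_le (s := l * U) (mul_nonneg hl hUpos.le)
          (inv_nonneg.2 (hM0 q).le) (inv_le_one_of_one_le₀ (hM q))
        rw [show l * U / M q = (M q)⁻¹ * (l * U) by rw [div_eq_inv_mul]]
        have h0 := bennettPsi_nonneg ((M q)⁻¹ * (l * U))
        calc v q * bennettPsi ((M q)⁻¹ * (l * U))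
            ≤ V * M q ^ 2 * bennettPsi ((M q)⁻¹ * (l * U)) := mul_le_mul_of_nonneg_right (hv q) h0
          _ = V * (M q ^ 2 * bennettPsi ((M q)⁻¹ * (l * U))) := by ring
          _ ≤ V * bennettPsi (l * U) := by
            refine mul_le_mul_of_nonneg_left ?_ hV
            calc M q ^ 2 * bennettPsi ((M q)⁻¹ * (l * U))
                ≤ M q ^ 2 * ((M q)⁻¹ ^ 2 * bennettPsi (l * U)) := by gcongr
              _ = bennettPsi (l * U) := by
                have := (hM0 q).ne'
                field_simp
    _ = _ := by rw [← Finset.sum_mul, hp1, one_mul]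

/-- Bennett's tail bound from a bound of the moment generating function. -/
theorem measureReal_ge_le_of_integral_exp_le [IsFiniteMeasure μ] {T : Ω → ℝ} {U V : ℝ}
    (hU : 0 < U) (hV : 0 < V)
    (hT : ∀ l : ℝ, 0 ≤ l → Integrable (fun w => Real.exp (l * T w)) μ ∧
      ∫ w, Real.exp (l * T w) ∂μ ≤ Real.exp (V * bennettPsi (l * U))) {t : ℝ} (ht : 0 < t) :
    μ.real {w | t ≤ T w} ≤ Real.exp (-V * bennettPhi (t / (U * V))) := by
  set x := t / (U * V) with hx
  have hx0 : 0 < x := by positivity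
  have htx : t = x * (U * V) := by rw [hx]; field_simp
  have hlog : 0 ≤ Real.log (1 + x) := Real.log_nonneg (by linarith)
  -- The minimiser of Vψ(lU) − lt.
  set l := Real.log (1 + x) / U with hl
  have hlU : l * U = Real.log (1 + x) := by rw [hl]; field_simp
  have hl0 : 0 ≤ l := div_nonneg hlog hU.le
  refine (measure_ge_le_exp_mul_mgf t hl0 (hT l hl0).1).trans ?_
  refine (mul_le_mul_of_nonneg_left (hT l hl0).2 (Real.exp_pos _).le).trans ?_
  rw [← Real.exp_add]
  refine le_of_eq (congrArg _ ?_)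
  rw [hlU, bennettPsi, Real.exp_log (by linarith), bennettPhi, htx,
    show -l * (x * (U * V)) = -(l * U) * (x * V) by ring, hlU]
  ring

end Combination

/-- The parabola touches the line x at x = 2. Its coefficient 1/4 is the source of the constant 5/4
= 1 + 1/4. -/
lemma max_one_le (x : ℝ) : max 1 x ≤ 1 + x ^ 2 / 4 :=
  max_le (by nlinarith [sq_nonneg x]) (by nlinarith [sq_nonneg (x - 2)])

/-! ### The pieces as functions of independent σ-algebras. -/

lemma sigmaOn_comap_eq {Ω ι 𝒳 : Type*} [MeasurableSpace 𝒳] (x : ι → Ω → 𝒳) (S : Set ι) :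
    sigmaOn (fun i => MeasurableSpace.comap (x i) inferInstance) S =
      MeasurableSpace.comap (fun w (i : S) => x i w) inferInstance := by
  rw [sigmaOn, MeasurableSpace.pi, MeasurableSpace.comap_iSup, iSup_subtype']
  simp only [MeasurableSpace.comap_comp]
  rfl

namespace MultiFracDecomposition

variable {Ω 𝒳 : Type*} [MeasurableSpace 𝒳] {K : ℕ} {m : Fin K → ℕ}
  {X : ∀ k, Fin (m k) → Ω → 𝒳} {G : ∀ k, SimpleGraph (Fin (m k))}
  {f : (∀ k, Fin (m k) → 𝒳) → ℝ}

lemma sigmaAlgDel_eq (D : MultiFracDecomposition G f) (X : ∀ k, Fin (m k) → Ω → 𝒳) (k : Fin K)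
    (j : Fin (D.J k)) (i : D.I k j) :
    D.sigmaAlgDel X k j i =
      sigmaOn (fun l : D.I k j => MeasurableSpace.comap (X k l) inferInstance) {i}ᶜ :=
  (sigmaOn_comap_eq (fun l : D.I k j => X k l) {i}ᶜ).symm

lemma sigmaAlg_eq (D : MultiFracDecomposition G f) (X : ∀ k, Fin (m k) → Ω → 𝒳) (k : Fin K)
    (j : Fin (D.J k)) :
    D.sigmaAlg X k j =
      sigmaOn (fun l : D.I k j => MeasurableSpace.comap (X k l) inferInstance) Set.univ := by
  rw [sigmaAlg, sigmaOn, MeasurableSpace.pi, MeasurableSpace.comap_iSup, iSup_univ]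
  simp only [MeasurableSpace.comap_comp]
  rfl

variable [MeasurableSpace Ω] {μ : Measure Ω} {D : MultiFracDecomposition G f}
  {Y : ∀ k (j : Fin (D.J k)), D.I k j → Ω → ℝ} {b σ : ∀ k, Fin (D.J k) → ℝ}

lemma PieceAssumption.b_nonneg [IsProbabilityMeasure μ] (hA : D.PieceAssumption μ X Y b σ)
    (k : Fin K) (j : Fin (D.J k)) (hX : ∀ k i, Measurable (X k i)) (i : D.I k j) : 0 ≤ b k j := by
  have hm : D.sigmaAlgDel X k j i ≤ ‹MeasurableSpace Ω› :=
    (measurable_pi_lambda _ fun l : {l : D.I k j // l ≠ i} => hX k l).comap_le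
  have h1 := condExp_mono (m := D.sigmaAlgDel X k j i) ((hA.memLp_Y k j i).integrable (by norm_num))
    (integrable_const (b k j)) (hA.Y_le k j i)
  rw [condExp_const hm] at h1
  obtain ⟨w, h2, h3⟩ := (h1.and (hA.condExp_nonneg k j i)).exists
  exact h3.trans h2

lemma PieceAssumption.subadditiveAssumption (hA : D.PieceAssumption μ X Y b σ)
    (hX : ∀ k i, Measurable (X k i)) (hG : ∀ k, IsDependencyGraph μ (X k) (G k)) (k : Fin K)
    (j : Fin (D.J k)) (hb : 0 ≤ b k j) :
    SubadditiveAssumption μ (fun l : D.I k j => MeasurableSpace.comap (X k l) inferInstance)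
      (D.Z X k j) (D.ZDel X k j) (Y k j) (b k j) (σ k j ^ 2) where
  le i := (hX k i).comap_le
  indep := hG k (D.I k j) ((D.cover k).indep j)
  stronglyMeasurable_Z := by
    rw [← sigmaAlg_eq]
    exact ((D.measurable_piece k j).comp (comap_measurable _)).stronglyMeasurable
  stronglyMeasurable_Zd i := by
    rw [← sigmaAlgDel_eq]
    exact ((D.measurable_deleted k j i).comp (comap_measurable _)).stronglyMeasurable
  integrable_Z := hA.integrable_Z k j
  memLp_Y := hA.memLp_Y k j
  Y_le_sub := hA.Y_le_sub k j
  sub_le_one := hA.sub_le_one k j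
  condExp_nonneg i := by rw [← sigmaAlgDel_eq]; exact hA.condExp_nonneg k j i
  Y_le := hA.Y_le k j
  sum_condExp_sq_le := by simp only [← sigmaAlgDel_eq]; exact hA.sum_condExp_sq_le k j
  sum_sub_le w := D.subadditive k j fun i => X k i w
  b_nonneg := hb

end MultiFracDecomposition

lemma IsFracIndepCover.exists_mem {V J : Type*} [DecidableEq V] [Fintype J] {G : SimpleGraph V}
    {I : J → Finset V} {ω : J → ℝ} (h : IsFracIndepCover G I ω) (u : V) : ∃ j, u ∈ I j := by
  by_contra! hc
  have := h.sum_eq_one u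
  simp [hc] at this

/-- From Bennett's to Bernstein's inequality. -/
lemma le_div_mul_bennettPhi {v W c t r : ℝ} (hv : 0 < v) (hW : 0 < W) (ht : 0 < t)
    (hc : c = 5 ^ 2 / 4 ^ 2 * W) (hr : r = √(2 * c * v * t) + 2 * c * t / 3) :
    t ≤ v / W * bennettPhi (4 * r / (5 * v)) := by
  have hc0 : 0 < c := by rw [hc]; positivity
  set q := √(2 * c * v * t) with hq
  have hq0 : 0 ≤ q := Real.sqrt_nonneg _
  have hq2 : q ^ 2 = 2 * c * v * t := Real.sq_sqrt (by positivity)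
  have hct : 0 < c * t := mul_pos hc0 ht
  have hr0 : 0 < r := by rw [hr]; positivity
  -- The 4/15 is one third of the factor 4/5 in the argument of φ. The chosen `r` would even allow
  -- r/3 in its place.
  have hkey : 2 * c * t * (v + 4 * r / 15) ≤ r ^ 2 := by
    have : r ^ 2 = 2 * c * v * t + 2 * q * (2 * (c * t) / 3) + (2 * (c * t) / 3) ^ 2 := by
      rw [hr, ← hq2]; ring
    rw [this, hr]
    nlinarith [mul_nonneg hct.le hq0, mul_pos hct hct]
  have hφ := sq_div_le_bennettPhi (x := 4 * r / (5 * v)) (by positivity)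
  refine le_trans ?_ (mul_le_mul_of_nonneg_left hφ (by positivity))
  have hWc : W = 16 / 25 * c := by rw [hc]; ring
  have e : v / W * ((4 * r / (5 * v)) ^ 2 / (2 * (1 + 4 * r / (5 * v) / 3))) =
      r ^ 2 / (2 * c * (v + 4 * r / 15)) := by
    rw [hWc]
    field_simp
    ring
  rw [e, le_div_iff₀ (by positivity)]
  linarith

/-! ### The tail bounds for the whole sum. -/

theorem mainTheorem1 {Ω 𝒳 : Type*} [MeasurableSpace Ω] [MeasurableSpace 𝒳]
    (μ : Measure Ω) [IsProbabilityMeasure μ]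
    {K : ℕ} {m : Fin K → ℕ} (hm : 0 < ∑ k, m k)
    (X : ∀ k, Fin (m k) → Ω → 𝒳) (hX : ∀ k i, Measurable (X k i))
    (G : ∀ k, SimpleGraph (Fin (m k))) (hG : ∀ k, IsDependencyGraph μ (X k) (G k))
    (f : (∀ k, Fin (m k) → 𝒳) → ℝ) (D : MultiFracDecomposition G f)
    (Y : ∀ k (j : Fin (D.J k)), D.I k j → Ω → ℝ) (bb σ : ∀ k, Fin (D.J k) → ℝ)
    (hA : D.PieceAssumption μ X Y bb σ)
    (b : ℝ) (hb : ∀ k j, bb k j = b)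
    (Z : Ω → ℝ) (hZ : ∀ w, Z w = f fun k i => X k i w)
    (v : ℝ) (hv : v = (1 + b) * (∫ w, Z w ∂μ) + ∑ k, ∑ j, D.ω k j * σ k j ^ 2)
    (vp : ∀ k, Fin (D.J k) → ℝ)
    (hvp : ∀ k j, vp k j = (1 + bb k j) * (∫ w, D.Z X k j w ∂μ) + σ k j ^ 2)
    (W : ℝ) (hW : W = ∑ k, fracChromaticNumber (G k))
    -- the fractional covers attain the fractional chromatic numbers
    (hWω : W = ∑ k, ∑ j, D.ω k j)
    (U : ℝ) (hU : U = ∑ k, ∑ j, D.ω k j * max 1 (√(vp k j) * √W / √v))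
    (c : ℝ) (hc : c = 5 ^ 2 / 4 ^ 2 * ∑ k, fracChromaticNumber (G k)) :
    (∀ t : ℝ, 0 < t →
      μ.real {w | Z w ≥ (∫ w', Z w' ∂μ) + t} ≤
          Real.exp (-(v / W) * bennettPhi (t * W / (U * v))) ∧
        Real.exp (-(v / W) * bennettPhi (t * W / (U * v))) ≤
          Real.exp (-(v / ∑ k, fracChromaticNumber (G k)) * bennettPhi (4 * t / (5 * v)))) ∧
    (∀ t : ℝ, 0 < t →
      μ.real {w | Z w ≥ (∫ w', Z w' ∂μ) + √(2 * c * v * t) + 2 * c * t / 3} ≤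
        Real.exp (-t)) := by
  -- Some vertex exists and is covered, so some I_kj is non-empty and yields b ≥ 0. As b is common
  -- to all pieces, this also serves those with empty I_kj.
  obtain ⟨k₀, -, hk₀⟩ := Finset.exists_ne_zero_of_sum_ne_zero hm.ne'
  obtain ⟨j₀, hj₀⟩ := (D.cover k₀).exists_mem (⟨0, Nat.pos_of_ne_zero hk₀⟩ : Fin (m k₀))
  have hb0 : 0 ≤ b := hb k₀ j₀ ▸ hA.b_nonneg k₀ j₀ hX ⟨_, hj₀⟩
  have hS : ∀ k j, _ := fun k j => hA.subadditiveAssumption hX hG k j ((hb k j).symm ▸ hb0)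
  have hω : ∀ k j, 0 < D.ω k j := fun k j => (D.cover k).weight_pos j
  rw [← hW] at hc ⊢
  let Q := Σ k, Fin (D.J k)
  have hsum : ∀ F : ∀ k, Fin (D.J k) → ℝ, ∑ k, ∑ j, F k j = ∑ q : Q, F q.1 q.2 := fun F =>
    (Fintype.sum_sigma' F).symm
  rw [hsum] at hv hWω hU
  have hWpos : 0 < W := by
    rw [hWω]
    exact Finset.sum_pos (fun q _ => hω _ _) ⟨⟨k₀, j₀⟩, Finset.mem_univ _⟩
  have hvp0 : ∀ k j, 0 ≤ vp k j := fun k j => by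
    rw [hvp, hb]
    exact add_nonneg (mul_nonneg (by linarith) (hS k j).integral_nonneg) (sq_nonneg _)
  have hZsum : ∀ w, Z w = ∑ q : Q, D.ω q.1 q.2 * D.Z X q.1 q.2 w := fun w => by
    rw [hZ, D.eq_sum_block, ← hsum fun k j => D.ω k j * D.Z X k j w]
    exact Finset.sum_congr rfl fun k _ => D.block_eq k _
  have hEZ : ∫ w, Z w ∂μ = ∑ q : Q, D.ω q.1 q.2 * ∫ w, D.Z X q.1 q.2 w ∂μ := by
    simp only [hZsum]
    rw [integral_finsetSum _ fun q _ => (hA.integrable_Z q.1 q.2).const_mul _]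
    exact Finset.sum_congr rfl fun q _ => integral_const_mul _ _
  have hvsum : v = ∑ q : Q, D.ω q.1 q.2 * vp q.1 q.2 := by
    rw [hv, hEZ, Finset.mul_sum, ← Finset.sum_add_distrib]
    refine Finset.sum_congr rfl fun q _ => ?_
    rw [hvp, hb]
    ring
  have hv0 : 0 ≤ v := by
    rw [hvsum]
    exact Finset.sum_nonneg fun q _ => mul_nonneg (hω _ _).le (hvp0 _ _)
  set M : Q → ℝ := fun q => max 1 (√(vp q.1 q.2) * √W / √v) with hM
  have hM1 : ∀ q, 1 ≤ M q := fun q => le_max_left _ _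
  have hWU : W ≤ U := by
    rw [hWω, hU]
    exact Finset.sum_le_sum fun q _ => le_mul_of_one_le_right (hω _ _).le (hM1 q)
  have hUpos : 0 < U := hWpos.trans_le hWU
  have hvq : ∀ q : Q, vp q.1 q.2 ≤ v / W * M q ^ 2 := by
    intro q
    rcases hv0.eq_or_lt with h0 | h0
    -- If v = 0, the positive weights force every v_q to vanish.
    · have h1 := Finset.sum_eq_zero_iff_of_nonneg
        (fun q : Q => fun _ => mul_nonneg (hω q.1 q.2).le (hvp0 q.1 q.2)) |>.1
        (hvsum.symm.trans h0.symm) q (Finset.mem_univ q)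
      have h2 := (mul_eq_zero.1 h1).resolve_left (hω _ _).ne'
      rw [h2, ← h0]
      simp
    · have h1 : (√(vp q.1 q.2) * √W / √v) ^ 2 ≤ M q ^ 2 :=
        pow_le_pow_left₀ (by positivity) (le_max_right _ _) 2
      rw [div_pow, mul_pow, Real.sq_sqrt (hvp0 _ _), Real.sq_sqrt hWpos.le,
        Real.sq_sqrt hv0] at h1
      calc vp q.1 q.2 = v / W * (vp q.1 q.2 * W / v) := by field_simp
        _ ≤ _ := by gcongr
  set T : Ω → ℝ := fun w => Z w - ∫ w', Z w' ∂μ with hT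
  have hmgf : ∀ l : ℝ, 0 ≤ l → Integrable (fun w => Real.exp (l * T w)) μ ∧
      ∫ w, Real.exp (l * T w) ∂μ ≤ Real.exp (v / W * bennettPsi (l * U)) := by
    intro l hl
    have h := integral_exp_sum_le (μ := μ) (ω := fun q : Q => D.ω q.1 q.2)
      (v := fun q : Q => vp q.1 q.2) (M := M)
      (T := fun (q : Q) w => D.Z X q.1 q.2 w - ∫ w', D.Z X q.1 q.2 w' ∂μ)
      (fun q => hω _ _) hM1 hU hUpos (div_nonneg hv0 hWpos.le) hvq
      (fun q l hl => by
        rw [hvp]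
        exact (hS q.1 q.2).integral_exp_sub_le hl) hl
    have e : ∀ w, ∑ q : Q, D.ω q.1 q.2 * (D.Z X q.1 q.2 w - ∫ w', D.Z X q.1 q.2 w' ∂μ) = T w := by
      intro w
      simp only [hT, mul_sub, Finset.sum_sub_distrib]
      rw [hEZ, hZsum]
    simpa only [e] using h
  have hset : ∀ t, {w | Z w ≥ (∫ w', Z w' ∂μ) + t} = {w | t ≤ T w} := fun t => by
    ext w
    simp only [hT, Set.mem_ofPred_eq, ge_iff_le]
    exact (le_sub_iff_add_le').symm
  have part1 : ∀ t : ℝ, 0 < t → μ.real {w | Z w ≥ (∫ w', Z w' ∂μ) + t} ≤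
        Real.exp (-(v / W) * bennettPhi (t * W / (U * v))) ∧
      Real.exp (-(v / W) * bennettPhi (t * W / (U * v))) ≤
        Real.exp (-(v / W) * bennettPhi (4 * t / (5 * v))) := by
    intro t ht
    rcases hv0.eq_or_lt with h0 | h0
    -- For v = 0 the factor v/W makes both right-hand sides equal to 1.
    · simp [← h0]
    constructor
    · have h := measureReal_ge_le_of_integral_exp_le hUpos (div_pos h0 hWpos) hmgf ht
      rw [hset]
      rwa [show t * W / (U * v) = t / (U * (v / W)) by field_simp]
    · have hU54 : U ≤ 5 / 4 * W := by
        -- The excess over W sums to W/4, because Σ ω_q v_q = v.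
        calc U ≤ ∑ q : Q, (D.ω q.1 q.2 + W / v / 4 * (D.ω q.1 q.2 * vp q.1 q.2)) := by
              rw [hU]
              refine Finset.sum_le_sum fun q _ => ?_
              have h1 := max_one_le (√(vp q.1 q.2) * √W / √v)
              rw [div_pow, mul_pow, Real.sq_sqrt (hvp0 _ _), Real.sq_sqrt hWpos.le,
                Real.sq_sqrt hv0] at h1
              refine (mul_le_mul_of_nonneg_left h1 (hω q.1 q.2).le).trans (le_of_eq ?_)
              ring
          _ = 5 / 4 * W := by
              rw [Finset.sum_add_distrib, ← Finset.mul_sum, ← hvsum, ← hWω]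
              field_simp
              ring
      refine Real.exp_le_exp.2 ?_
      have hle : 4 * t / (5 * v) ≤ t * W / (U * v) := by
        rw [div_le_div_iff₀ (by positivity) (by positivity)]
        nlinarith [mul_pos ht h0]
      have h := monotoneOn_bennettPhi (Set.mem_Ici.2 (by positivity))
        (Set.mem_Ici.2 (by positivity)) hle
      have := mul_le_mul_of_nonneg_left h (div_pos h0 hWpos).le
      linarith
  refine ⟨part1, fun t ht => ?_⟩
  have hc0 : 0 < c := by rw [hc]; positivity
  rw [show {w | Z w ≥ (∫ w', Z w' ∂μ) + √(2 * c * v * t) + 2 * c * t / 3} =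
    {w | Z w ≥ (∫ w', Z w' ∂μ) + (√(2 * c * v * t) + 2 * c * t / 3)} by simp only [add_assoc]]
  have hr0 : 0 < √(2 * c * v * t) + 2 * c * t / 3 := by positivity
  rcases hv0.eq_or_lt with h0 | h0
  -- For v = 0 the centred mgf is at most 1 for all l ≥ 0, and Chernoff at l = t/r gives exactly
  -- e^{−t}.
  · rw [hset]
    set r := √(2 * c * v * t) + 2 * c * t / 3
    have hl0 : 0 ≤ t / r := by positivity
    refine (measure_ge_le_exp_mul_mgf r hl0 (hmgf _ hl0).1).trans ?_
    refine (mul_le_mul_of_nonneg_left (hmgf _ hl0).2 (Real.exp_pos _).le).trans (le_of_eq ?_)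
    rw [← h0, zero_div, zero_mul, Real.exp_zero, mul_one, neg_mul, div_mul_cancel₀ _ hr0.ne']
  · refine ((part1 _ hr0).1.trans (part1 _ hr0).2).trans (Real.exp_le_exp.2 ?_)
    have := le_div_mul_bennettPhi h0 hWpos ht hc rfl
    linarith
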